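/- **Conventions.** For a metric space $Z$ let $\mathrm{Lip}_{\mathrm{loc}}(Z)$ be the real functions on $Z$ that are Lipschitz on every bounded set, $\mathrm{Lip}_{\mathrm{bs}}(Z)$ the Lipschitz functions with bounded support, and $\mathcal D^m(Z)=\mathrm{Lip}_{\mathrm{bs}}(Z)\times[\mathrm{Lip}_{\mathrm{loc}}(Z)]^m$, $m\ge 0$. An *$m$-dimensional metric functional* on $Z$ is a function $T:\mathcal D^m(Z)\to\mathbb R$ that is multilinear; continuous, i.e. $T(f,\pi^j)\to T(f,\pi)$ whenever $\pi^j_i\to\pi_i$ pointwise for each $i$ and $\sup_{i,j}\mathrm{Lip}(\pi_i^j|_A)<\infty$ for every bounded $A\subset Z$; and local, i.e. $T(f,\pi)=0$ whenever some $\pi_i$ is constant on $\{z: d(z,\operatorname{spt} f)\le\delta\}$ for some $\delta>0$. If $m\ge1$, its boundary is $\partial T(f,\pi_1,\dots,\pi_{m-1})=T(\sigma,f,\pi_1,\dots,\pi_{m-1})$ for any $\sigma\in\mathrm{Lip}_{\mathrm{bs}}(Z)$ with $\sigma=1$ on $\operatorname{spt} f$. If $\varphi:Z\to Z'$ is Lipschitz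 on bounded sets and preimages of bounded sets under $\varphi$ are bounded, then $\varphi_\#T(f,\pi)=T(f\circ\varphi,\pi_1\circ\varphi,\dots,\pi_m\circ\varphi)$. For $V\subset Z$ open, $\mathbf M_V(T)=\sup\sum_\lambda T(f_\lambda,\pi_\lambda)$ over all finite families with $f_\lambda\in\mathrm{Lip}_{\mathrm{bs}}(Z)$, $\operatorname{spt} f_\lambda\subset V$, $\sum_\lambda|f_\lambda|\le1$, and $\pi_{\lambda,i}$ $1$-Lipschitz on $Z$; for $A\subset Z$, $\|T\|(A)=\inf\{\mathbf M_V(T): V\supset A\text{ open}\}$; and $\operatorname{spt}T=\{z:\|T\|(\{w : d(z,w)\le r\})>0\ \text{for all } r>0\}$. A metric functional $T$ is *locally integer rectifiable* if (i) for every bounded open $U\subset Z$ and $\epsilon>0$ there is a set $C\subset U$, a finite union of Lipschitz images of compact subsets of $\mathbb R^m$, with $\mathbf M_U(T)<\infty$ and $\mathbf M_{U\setminus C}(T)<\epsilon$; and (ii) for every bounded Borel set $B\subset Z$ and every Lipschitz $\pi:Z\to\mathbb R^m$ there is $\theta\in L^1(\mathbb R^m,\mathbb Z)$ such that $T(1_B\,(f\circ\pi),g_1\circ\pi,\dots,g_m\circ\pi)=\int_{\mathbb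 R^m}\theta f\det(\nabla g)\,d\mathcal L^m$ for all $(f,g)\in\mathcal D^m(\mathbb R^m)$. In (ii), $T$ denotes its extension to tuples whose first entry is a bounded Borel function $h$ of bounded support: $T(h,\tau)=\lim_k T(f_k,\tau)$ for any $f_k\in\mathrm{Lip}_{\mathrm{bs}}(Z)$ with supports in a common bounded set and $f_k\to h$ in $L^1(\|T\|)$. We write $\mathbf I_{\mathrm{loc},m}(Z)$ for the set of *locally integral currents*: the locally integer rectifiable $T$ such that, if $m\ge1$, $\partial T$ is locally integer rectifiable as well. If $T\in\mathbf I_{\mathrm{loc},m}(Z)$ and $\operatorname{spt}T\subset Y\subset Z$, then $T$ is also viewed as a functional on $\mathcal D^m(Y)$, by evaluating it on arbitrary extensions, in $\mathrm{Lip}_{\mathrm{bs}}(Z)$ and $\mathrm{Lip}_{\mathrm{loc}}(Z)$ respectively, of the given functions on $Y$ (the value does not depend on the extensions). A sequence $(T_n)$ in $\mathbf I_{\mathrm{loc},m}(Z)$ *converges in the local flat topology* to $T\in\mathbf I_{\mathrm{loc},m}(Z)$ if for every bounded closed $B\subset Z$ there are $S_n\in\mathbf I_{\mathrm{loc},m+1}(Z)$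 with $\|T-T_n-\partial S_n\|(B)+\|S_n\|(B)\to0$. **Proposition.** Let $m\ge0$, let $(X_n)$ be a sequence of complete metric spaces, $x_n\in X_n$, and $T_n\in\mathbf I_{\mathrm{loc},m}(X_n)$. Suppose there are complete metric spaces $Z,Z'$ with basepoints $z_0\in Z$, $z_0'\in Z'$ and isometric (i.e. distance preserving) embeddings $\varphi_n:X_n\to Z$, $\varphi_n':X_n\to Z'$ such that $\varphi_n(x_n)\to z_0$, $\varphi_n'(x_n)\to z_0'$, $(\varphi_{n\#}T_n)$ converges in the local flat topology to $T\in\mathbf I_{\mathrm{loc},m}(Z)$, and $(\varphi'_{n\#}T_n)$ converges in the local flat topology to $T'\in\mathbf I_{\mathrm{loc},m}(Z')$. Then there is a surjective isometry $\psi:\{z_0\}\cup\operatorname{spt}T\to\{z_0'\}\cup\operatorname{spt}T'$ with $\psi(z_0)=z_0'$ and $\psi_\#T=T'$, where $T$ is viewed as a functional on $\mathcal D^m(\{z_0\}\cup\operatorname{spt}T)$ and $\psi$ as a map into $Z'$. -/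

import Mathlib

open Filter Topology Bornology MeasureTheory Set
open scoped NNReal ENNReal

namespace MetricCurrents

/-! ### Lipschitz functions on metric spaces -/

section Lipschitz

variable {Z Z' : Type*} [MetricSpace Z] [MetricSpace Z']

/-- `φ` is Lipschitz on every bounded set. -/
def IsLipLoc (φ : Z → Z') : Prop :=
  ∀ A : Set Z, IsBounded A → ∃ K : ℝ≥0, LipschitzOnWith K φ A

theorem _root_.LipschitzWith.isLipLoc {φ : Z → Z'} {K : ℝ≥0} (h : LipschitzWith K φ) :
    IsLipLoc φ := fun _ _ => ⟨K, h.lipschitzOnWith⟩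

theorem IsLipLoc.isBounded_image {φ : Z → Z'} (h : IsLipLoc φ) {A : Set Z} (hA : IsBounded A) :
    IsBounded (φ '' A) := by
  obtain ⟨K, hK⟩ := h A hA
  obtain ⟨C, hC⟩ := Metric.isBounded_iff.1 hA
  refine Metric.isBounded_iff.2 ⟨K * C, ?_⟩
  rintro _ ⟨x, hx, rfl⟩ _ ⟨y, hy, rfl⟩
  exact (hK.dist_le_mul x hx y hy).trans (by gcongr; exact hC hx hy)

theorem IsLipLoc.comp {Z'' : Type*} [MetricSpace Z''] {g : Z' → Z''} {φ : Z → Z'}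
    (hg : IsLipLoc g) (hφ : IsLipLoc φ) : IsLipLoc (g ∘ φ) := by
  intro A hA
  obtain ⟨K, hK⟩ := hφ A hA
  obtain ⟨L, hL⟩ := hg _ (hφ.isBounded_image hA)
  exact ⟨L * K, hL.comp hK (mapsTo_image _ _)⟩

theorem IsLipLoc.add {f g : Z → ℝ} (hf : IsLipLoc f) (hg : IsLipLoc g) : IsLipLoc (f + g) := by
  intro A hA
  obtain ⟨K, hK⟩ := hf A hA
  obtain ⟨L, hL⟩ := hg A hA
  exact ⟨K + L, hK.add hL⟩

theorem IsLipLoc.mul {f g : Z → ℝ} (hf : IsLipLoc f) (hg : IsLipLoc g) : IsLipLoc (f * g) := by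
  intro A hA
  obtain ⟨K, hK⟩ := hf A hA
  obtain ⟨L, hL⟩ := hg A hA
  obtain ⟨M, hM⟩ := (hf.isBounded_image hA).exists_norm_le
  obtain ⟨N, hN⟩ := (hg.isBounded_image hA).exists_norm_le
  refine ⟨M.toNNReal * L + N.toNNReal * K, LipschitzOnWith.of_dist_le_mul fun x hx y hy => ?_⟩
  have h1 : |f x| ≤ M.toNNReal := (hM _ (mem_image_of_mem f hx)).trans (Real.le_coe_toNNReal M)
  have h2 : |g y| ≤ N.toNNReal := (hN _ (mem_image_of_mem g hy)).trans (Real.le_coe_toNNReal N)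
  have h3 := hK.dist_le_mul x hx y hy
  have h4 := hL.dist_le_mul x hx y hy
  rw [Real.dist_eq] at h3 h4 ⊢
  have h5 : (f * g) x - (f * g) y = f x * (g x - g y) + g y * (f x - f y) := by
    simp only [Pi.mul_apply]; ring
  rw [h5]
  refine (abs_add_le _ _).trans ?_
  rw [abs_mul, abs_mul]
  push_cast
  have := mul_le_mul h1 h4 (abs_nonneg _) (by positivity)
  have := mul_le_mul h2 h3 (abs_nonneg _) (by positivity)
  linarith

/-- A function with bounded support that is Lipschitz on bounded sets is Lipschitz. -/
theorem IsLipLoc.exists_lipschitzWith {f : Z → ℝ} (hf : IsLipLoc f)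
    (hs : IsBounded (tsupport f)) : ∃ K : ℝ≥0, LipschitzWith K f := by
  obtain ⟨K, hK⟩ := hf _ (hs.cthickening (δ := 1))
  obtain ⟨M, hM⟩ := (hf.isBounded_image hs).exists_norm_le
  have key : ∀ x ∈ tsupport f, ∀ y, dist (f x) (f y) ≤ (K + M.toNNReal : ℝ≥0) * dist x y := by
    intro x hx y
    have hxM : |f x| ≤ M.toNNReal := (hM _ (mem_image_of_mem f hx)).trans (Real.le_coe_toNNReal M)
    push_cast
    have hd : 0 ≤ dist x y := dist_nonneg
    rcases le_total (dist x y) 1 with h | h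
    · have hy : y ∈ Metric.cthickening 1 (tsupport f) :=
        Metric.mem_cthickening_of_dist_le y x 1 _ hx (by rwa [dist_comm])
      have := hK.dist_le_mul x (Metric.self_subset_cthickening _ hx) y hy
      nlinarith [M.toNNReal.2, mul_nonneg M.toNNReal.2 hd]
    · by_cases hy : y ∈ tsupport f
      · have := hK.dist_le_mul x (Metric.self_subset_cthickening _ hx) y
          (Metric.self_subset_cthickening _ hy)
        nlinarith [M.toNNReal.2, mul_nonneg M.toNNReal.2 hd]
      · rw [image_eq_zero_of_notMem_tsupport hy, Real.dist_eq, sub_zero]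
        nlinarith [M.toNNReal.2, mul_nonneg K.2 hd,
          mul_le_mul_of_nonneg_left h M.toNNReal.2]
  refine ⟨K + M.toNNReal, LipschitzWith.of_dist_le_mul fun x y => ?_⟩
  by_cases hx : x ∈ tsupport f
  · exact key x hx y
  by_cases hy : y ∈ tsupport f
  · rw [dist_comm, dist_comm x y]; exact key y hy x
  · rw [image_eq_zero_of_notMem_tsupport hx, image_eq_zero_of_notMem_tsupport hy, dist_self]
    positivity

variable (Z) in
/-- The algebra of real functions on `Z` that are Lipschitz on bounded sets. -/
def LipLoc : Subalgebra ℝ (Z → ℝ) where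
  carrier := {f | IsLipLoc f}
  mul_mem' := IsLipLoc.mul
  add_mem' := IsLipLoc.add
  algebraMap_mem' r := (LipschitzWith.const r).isLipLoc

variable (Z) in
/-- The space of Lipschitz functions on `Z` with bounded support (these are bounded). -/
def LipBS : Submodule ℝ (Z → ℝ) where
  carrier := {f | (∃ K : ℝ≥0, LipschitzWith K f) ∧ IsBounded (tsupport f)}
  add_mem' := by
    rintro f g ⟨⟨K, hK⟩, hf⟩ ⟨⟨L, hL⟩, hg⟩
    exact ⟨⟨K + L, hK.add hL⟩, (hf.union hg).subset (tsupport_add f g)⟩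
  zero_mem' := ⟨⟨0, LipschitzWith.const 0⟩, by simp [tsupport]⟩
  smul_mem' := by
    rintro c f ⟨⟨K, hK⟩, hf⟩
    have hb : IsBounded (tsupport (c • f)) :=
      hf.subset (closure_mono (Function.support_const_smul_subset c f))
    exact ⟨IsLipLoc.exists_lipschitzWith
      ((LipschitzWith.const c).isLipLoc.mul hK.isLipLoc) hb, hb⟩

/-- A Lipschitz function with bounded support, seen as an element of `LipLoc Z`. -/
def LipBS.toLipLoc (f : LipBS Z) : LipLoc Z :=
  ⟨f.1, f.2.1.choose_spec.isLipLoc⟩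

/-- Composition of an element of `LipLoc Z'` with a map that is Lipschitz on bounded sets. -/
def LipLoc.comp (g : LipLoc Z') (φ : Z → Z') (hφ : IsLipLoc φ) : LipLoc Z :=
  ⟨g.1 ∘ φ, IsLipLoc.comp g.2 hφ⟩

/-- The maps along which currents can be pushed forward: Lipschitz on bounded sets, and
preimages of bounded sets are bounded. -/
structure IsAdmissible (φ : Z → Z') : Prop where
  isLipLoc : IsLipLoc φ
  isBounded_preimage : ∀ A : Set Z', IsBounded A → IsBounded (φ ⁻¹' A)

theorem _root_.Isometry.isAdmissible {φ : Z → Z'} (hφ : Isometry φ) : IsAdmissible φ where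
  isLipLoc := hφ.lipschitz.isLipLoc
  isBounded_preimage _ hA := hφ.antilipschitz.isBounded_preimage hA

theorem _root_.Isometry.isAdmissible_coe {A : Set Z} {A' : Set Z'} {ψ : A → A'} (hψ : Isometry ψ) :
    IsAdmissible (fun y => (ψ y : Z')) :=
  Isometry.isAdmissible (isometry_subtype_coe.comp hψ)

/-- Composition of a Lipschitz function of bounded support with an admissible map. -/
def LipBS.comp (f : LipBS Z') (φ : Z → Z') (hφ : IsAdmissible φ) : LipBS Z :=
  ⟨f.1 ∘ φ, by
    have hb : IsBounded (tsupport (f.1 ∘ φ)) := by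
      refine IsBounded.closure ((hφ.isBounded_preimage _ f.2.2).subset ?_)
      intro z hz
      exact subset_tsupport f.1 hz
    exact ⟨IsLipLoc.exists_lipschitzWith (IsLipLoc.comp (LipBS.toLipLoc f).2 hφ.isLipLoc) hb, hb⟩⟩

/-- A bounded set admits a Lipschitz cut-off function of bounded support. -/
theorem exists_cutoff {A : Set Z} (hA : IsBounded A) :
    ∃ σ : LipBS Z, ∀ z ∈ A, σ.1 z = 1 := by
  have hl : LipschitzWith 1 (fun z => ((thickenedIndicator one_pos A z : ℝ≥0) : ℝ)) := by
    have h := lipschitzWith_thickenedIndicator one_pos A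
    refine LipschitzWith.of_dist_le_mul fun x y => ?_
    have := h.dist_le_mul x y
    simpa [NNReal.dist_eq, Real.dist_eq] using this
  refine ⟨⟨fun z => ((thickenedIndicator one_pos A z : ℝ≥0) : ℝ), ⟨_, hl⟩, ?_⟩, fun z hz => ?_⟩
  · refine ((hA.thickening (δ := 1)).subset fun z hz => ?_).closure
    by_contra h
    exact hz (by simp [thickenedIndicator_zero one_pos A h])
  · simp [thickenedIndicator_one one_pos A hz]

/-- Every Lipschitz function of bounded support on a subset extends to the whole space. -/
theorem LipBS.exists_extension {Y : Set Z} (f : LipBS Y) :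
    ∃ F : LipBS Z, ∀ y : Y, F.1 y = f.1 y := by
  obtain ⟨⟨K, hK⟩, hs⟩ := f.2
  have hl : LipschitzOnWith K (Function.extend Subtype.val f.1 0) Y := by
    intro a ha b hb
    have h1 := Subtype.val_injective.extend_apply f.1 0 ⟨a, ha⟩
    have h2 := Subtype.val_injective.extend_apply f.1 0 ⟨b, hb⟩
    simp only at h1 h2
    rw [h1, h2]
    exact hK ⟨a, ha⟩ ⟨b, hb⟩
  obtain ⟨G, hG, hGf⟩ := hl.extend_real
  have hb : IsBounded (Subtype.val '' tsupport f.1) :=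
    (LipschitzWith.subtype_val Y).isLipLoc.isBounded_image hs
  obtain ⟨σ, hσ⟩ := exists_cutoff hb
  have hb' : IsBounded (tsupport (σ.1 * G)) :=
    σ.2.2.subset (closure_mono (Function.support_mul_subset_left _ _))
  refine ⟨⟨σ.1 * G, IsLipLoc.exists_lipschitzWith ((LipBS.toLipLoc σ).2.mul hG.isLipLoc) hb', hb'⟩,
    fun y => ?_⟩
  have h1 : G y = f.1 y := by
    rw [← hGf y.2, Subtype.val_injective.extend_apply]
  by_cases hy : y ∈ tsupport f.1
  · simp [h1, hσ _ (mem_image_of_mem _ hy)]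
  · simp [h1, image_eq_zero_of_notMem_tsupport hy]

/-- Every function on a subset that is Lipschitz on bounded sets extends to such a function on
the whole space. -/
theorem LipLoc.exists_extension {Y : Set Z} (f : LipLoc Y) :
    ∃ F : LipLoc Z, ∀ y : Y, F.1 y = f.1 y := by
  rcases Y.eq_empty_or_nonempty with rfl | ⟨y₀, -⟩
  · exact ⟨0, fun y => y.2.elim⟩
  have hG : ∀ k : ℕ, ∃ G : Z → ℝ, IsLipLoc G ∧ ∀ y : Y, dist (y : Z) y₀ ≤ k + 1 → G y = f.1 y := by
    intro k
    have hb : IsBounded {y : Y | dist (y : Z) y₀ ≤ k + 1} := by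
      have := (isometry_subtype_coe (s := Y)).isAdmissible.isBounded_preimage _
        (Metric.isBounded_closedBall (x := y₀) (r := (k : ℝ) + 1))
      exact this
    obtain ⟨K, hK⟩ := f.2 _ hb
    have hl : LipschitzOnWith K (Function.extend Subtype.val f.1 0)
        (Subtype.val '' {y : Y | dist (y : Z) y₀ ≤ k + 1}) := by
      rintro _ ⟨x, hx, rfl⟩ _ ⟨y, hy, rfl⟩
      rw [Subtype.val_injective.extend_apply, Subtype.val_injective.extend_apply]
      exact hK hx hy
    obtain ⟨G, hG, hGf⟩ := hl.extend_real
    refine ⟨G, hG.isLipLoc, fun y hy => ?_⟩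
    rw [← hGf (mem_image_of_mem _ hy), Subtype.val_injective.extend_apply]
  choose G hGl hGf using hG
  let η : ℕ → Z → ℝ := fun k z => max 0 (1 - |dist z y₀ - k|)
  have hη : ∀ k, IsLipLoc (η k) := by
    intro k
    refine LipschitzWith.isLipLoc (K := 1) (LipschitzWith.of_dist_le_mul fun x y => ?_)
    have h1 := abs_dist_sub_le x y y₀
    have h2 := abs_max_sub_max_le_abs (1 - |dist x y₀ - k|) (1 - |dist y y₀ - k|) 0
    have h3 := abs_abs_sub_abs_le_abs_sub (dist y y₀ - k) (dist x y₀ - k)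
    simp only [η, Real.dist_eq, max_comm (0 : ℝ), NNReal.coe_one, one_mul]
    refine h2.trans ?_
    rw [show 1 - |dist x y₀ - k| - (1 - |dist y y₀ - k|)
      = |dist y y₀ - k| - |dist x y₀ - k| by ring]
    refine h3.trans ?_
    rw [show dist y y₀ - k - (dist x y₀ - k) = -(dist x y₀ - dist y y₀) by ring, abs_neg]
    exact h1
  have hzero : ∀ (k : ℕ) z, dist z y₀ + 1 ≤ k → η k z = 0 := by
    intro k z h
    simp only [η]
    rw [max_eq_left]
    rw [abs_of_nonpos (by linarith)]
    linarith
  let P : ℕ → Z → ℝ := fun N => ∑ k ∈ Finset.range N, η k * G k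
  have hP : ∀ N, IsLipLoc (P N) := by
    intro N
    have h : P N ∈ LipLoc Z := Subalgebra.sum_mem _ fun k _ => (hη k).mul (hGl k)
    exact h
  have hPc : ∀ (N M : ℕ) z, dist z y₀ + 1 ≤ N → N ≤ M → P M z = P N z := by
    intro N M z hN hNM
    simp only [P, Finset.sum_apply, Pi.mul_apply]
    symm
    refine Finset.sum_subset (Finset.range_mono hNM) fun k _ hk => ?_
    rw [hzero k z, zero_mul]
    have : (N : ℝ) ≤ k := by exact_mod_cast not_lt.1 (fun h => hk (Finset.mem_range.2 h))
    linarith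
  let F : Z → ℝ := fun z => P (⌈dist z y₀⌉₊ + 1) z
  have hF : ∀ (M : ℕ) z, dist z y₀ + 1 ≤ M → F z = P M z := by
    intro M z hM
    refine (hPc _ M z ?_ ?_).symm
    · push_cast; linarith [Nat.le_ceil (dist z y₀)]
    · have hM1 : 1 ≤ M := by
        have : (1 : ℝ) ≤ M := by linarith [dist_nonneg (x := z) (y := y₀)]
        exact_mod_cast this
      obtain ⟨M, rfl⟩ := Nat.exists_eq_add_of_le' hM1
      push_cast at hM
      have : ⌈dist z y₀⌉₊ ≤ M := Nat.ceil_le.2 (by linarith)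
      omega
  refine ⟨⟨F, fun A hA => ?_⟩, fun y => ?_⟩
  · obtain ⟨R, hR⟩ := hA.subset_closedBall y₀
    obtain ⟨K, hK⟩ := hP (⌈R⌉₊ + 1) A hA
    refine ⟨K, fun x hx y hy => ?_⟩
    have h : ∀ x ∈ A, F x = P (⌈R⌉₊ + 1) x := fun x hx => hF _ x (by
      push_cast; linarith [Nat.le_ceil R, Metric.mem_closedBall.1 (hR hx)])
    rw [h x hx, h y hy]
    exact hK hx hy
  · set r := dist (y : Z) y₀ with hr
    have hr0 : 0 ≤ r := dist_nonneg
    have hk : ∀ k : ℕ, (η k * G k) (y : Z) = η k y * f.1 y := by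
      intro k
      rcases le_total r (k + 1) with h | h
      · rw [Pi.mul_apply, hGf k y h]
      · have : η k (y : Z) = 0 := by
          simp only [η, ← hr]
          rw [max_eq_left]
          rw [abs_of_nonneg (by linarith)]
          linarith
        simp [this]
    have hsum : ∀ z : Z, ∑ k ∈ Finset.range (⌊dist z y₀⌋₊ + 2), η k z = 1 := by
      intro z
      have h1 := Nat.floor_le (dist_nonneg (x := z) (y := y₀))
      have h2 := Nat.lt_floor_add_one (dist z y₀)
      rw [Finset.sum_range_succ, Finset.sum_range_succ, Finset.sum_eq_zero]
      · simp only [η]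
        rw [abs_of_nonneg (by linarith), abs_of_nonpos (by push_cast; linarith),
          max_eq_right (by linarith), max_eq_right (by push_cast; linarith)]
        push_cast; ring
      · intro k hk
        have : (k : ℝ) + 1 ≤ ⌊dist z y₀⌋₊ := by exact_mod_cast Finset.mem_range.1 hk
        simp only [η]
        rw [max_eq_left]
        rw [abs_of_nonneg (by linarith)]
        linarith
    change F y = _
    rw [hF (⌊r⌋₊ + 2) y (by push_cast; linarith [Nat.lt_floor_add_one r])]
    simp only [P, Finset.sum_apply, hk]
    rw [← Finset.sum_mul, hsum, one_mul]

end Lipschitz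

/-! ### Metric functionals -/

section Functionals

variable {Z Z' : Type*} [MetricSpace Z] [MetricSpace Z'] {m : ℕ}

/-- Real functions on the set of tuples `(f, π₁, …, πₘ)` with `f` Lipschitz of bounded support
and `πᵢ` Lipschitz on bounded sets. -/
abbrev Functional (Z : Type*) [MetricSpace Z] (m : ℕ) : Type _ :=
  LipBS Z → (Fin m → LipLoc Z) → ℝ

/-- Linearity in each of the `m + 1` arguments. -/
def IsMultilinear (T : Functional Z m) : Prop :=
  (∀ π, IsLinearMap ℝ fun f => T f π) ∧
  ∀ f π i, IsLinearMap ℝ fun g : LipLoc Z => T f (Function.update π i g)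

/-- Metric functionals: multilinear, continuous and local. -/
structure IsMetricFunctional (T : Functional Z m) : Prop where
  multilinear : IsMultilinear T
  continuous : ∀ (f : LipBS Z) (π : Fin m → LipLoc Z) (πs : ℕ → Fin m → LipLoc Z),
    (∀ i z, Tendsto (fun j => (πs j i).1 z) atTop (𝓝 ((π i).1 z))) →
    (∀ A : Set Z, IsBounded A → ∃ K : ℝ≥0, ∀ j i, LipschitzOnWith K (πs j i).1 A) →
    Tendsto (fun j => T f (πs j)) atTop (𝓝 (T f π))
  isLocal : ∀ (f : LipBS Z) (π : Fin m → LipLoc Z),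
    (∃ i, ∃ δ > (0 : ℝ), ∃ c : ℝ, ∀ z ∈ Metric.cthickening δ (tsupport f.1), (π i).1 z = c) →
    T f π = 0

/-- The push-forward `φ_# T (f, π) = T (f ∘ φ, π ∘ φ)`. -/
def pushforward (T : Functional Z m) (φ : Z → Z') (hφ : IsAdmissible φ) : Functional Z' m :=
  fun f π => T (LipBS.comp f φ hφ) fun i => LipLoc.comp (π i) φ hφ.isLipLoc

/-- The boundary `∂T (f, π) = T (σ, f, π)`, where `σ` is a Lipschitz function of bounded support
that equals `1` on the support of `f`. For metric functionals the value does not depend on `σ`. -/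
noncomputable def boundary (T : Functional Z (m + 1)) : Functional Z m :=
  fun f π => T (exists_cutoff f.2.2).choose (Fin.cons (LipBS.toLipLoc f) π)

/-- The functional induced by `T` on a subset `Y` containing its support: it is evaluated by
extending the functions from `Y` to the whole space (always possible). For currents of locally
finite mass the value does not depend on the extensions. -/
noncomputable def onSubset (T : Functional Z m) (Y : Set Z) : Functional Y m :=
  fun f π => T (LipBS.exists_extension f).choose fun i => (LipLoc.exists_extension (π i)).choose

/-- The mass of `T` in the open set `V`. -/
noncomputable def mass (T : Functional Z m) (V : Set Z) : ℝ≥0∞ :=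
  ⨆ (k : ℕ) (f : Fin k → LipBS Z) (π : Fin k → Fin m → LipLoc Z)
    (_ : ∀ l i, LipschitzWith 1 (π l i).1) (_ : ∀ l, tsupport (f l).1 ⊆ V)
    (_ : ∀ z, ∑ l, |(f l).1 z| ≤ 1), ENNReal.ofReal (∑ l, T (f l) (π l))

/-- The set function `‖T‖`. -/
noncomputable def massOn (T : Functional Z m) (A : Set Z) : ℝ≥0∞ :=
  ⨅ (V : Set Z) (_ : IsOpen V) (_ : A ⊆ V), mass T V

/-- The support of `T`. -/
def spt (T : Functional Z m) : Set Z :=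
  {z | ∀ r > (0 : ℝ), 0 < massOn T (Metric.closedBall z r)}

open Classical in
/-- `‖T‖` as a measure on the Borel sets. For a current of locally finite mass `massOn T` is an
outer measure (so that it agrees with `boundedBy (massOn T)`) for which Borel sets are
measurable. -/
noncomputable def massMeasure [MeasurableSpace Z] (T : Functional Z m) : Measure Z :=
  if h : ‹MeasurableSpace Z› ≤ (OuterMeasure.boundedBy (massOn T)).caratheodory then
    (OuterMeasure.boundedBy (massOn T)).toMeasure h
  else 0

/-- `v` is the limit of `T (fₖ, π)` for some Lipschitz functions `fₖ`, with supports in a common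
bounded set, that converge to `g` in `L¹(‖T‖)`. -/
def IsExtendedValue (T : Functional Z m) (g : Z → ℝ) (π : Fin m → LipLoc Z) (v : ℝ) : Prop :=
  letI : MeasurableSpace Z := borel Z
  ∃ f : ℕ → LipBS Z, (∃ N : Set Z, IsBounded N ∧ ∀ k, tsupport (f k).1 ⊆ N) ∧
    Tendsto (fun k => ∫⁻ z, ENNReal.ofReal |(f k).1 z - g z| ∂massMeasure T) atTop (𝓝 0) ∧
    Tendsto (fun k => T (f k) π) atTop (𝓝 v)

open Classical in
/-- The extension of a current `T` of locally finite mass to tuples `(g, π)` whose first entry `g`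
is a bounded Borel function of bounded support; for these the value in question exists and is
unique. -/
noncomputable def extended (T : Functional Z m) (g : Z → ℝ) (π : Fin m → LipLoc Z) : ℝ :=
  if h : ∃ v, IsExtendedValue T g π v then h.choose else 0

/-- The functional `[θ] (f, g) = ∫ θ f det(∇g)` on `ℝᵐ`. -/
noncomputable def ofDensity (θ : EuclideanSpace ℝ (Fin m) → ℤ) :
    Functional (EuclideanSpace ℝ (Fin m)) m :=
  fun f g => ∫ x, (θ x : ℝ) * f.1 x *
    (Matrix.of fun i j => fderiv ℝ (g i).1 x (EuclideanSpace.single j 1)).det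

/-- Finite unions of Lipschitz images of compact subsets of `ℝᵐ`. -/
def IsCompactRectifiable (m : ℕ) (C : Set Z) : Prop :=
  ∃ (k : ℕ) (K : Fin k → Set (EuclideanSpace ℝ (Fin m)))
    (q : Fin k → EuclideanSpace ℝ (Fin m) → Z),
    (∀ l, IsCompact (K l) ∧ ∃ L : ℝ≥0, LipschitzOnWith L (q l) (K l)) ∧ C = ⋃ l, q l '' K l

/-- Locally integer rectifiable currents. The third condition says that `π_# (T ⌞ B) = [θ]`,
where `π_# (T ⌞ B) (f, g) = T (1_B (f ∘ π), g ∘ π)`. -/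
structure IsLocallyIntegerRectifiable (T : Functional Z m) : Prop where
  isMetricFunctional : IsMetricFunctional T
  rectifiable : ∀ U : Set Z, IsOpen U → IsBounded U → ∀ ε > (0 : ℝ≥0∞),
    ∃ C ⊆ U, IsCompactRectifiable m C ∧ mass T U < ∞ ∧ mass T (U \ C) < ε
  integer : ∀ B : Set Z, IsBounded B → MeasurableSet[borel Z] B →
    ∀ (π : Z → EuclideanSpace ℝ (Fin m)) (K : ℝ≥0) (hπ : LipschitzWith K π),
    ∃ θ : EuclideanSpace ℝ (Fin m) → ℤ, Integrable (fun x => (θ x : ℝ)) ∧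
      ∀ (f : LipBS (EuclideanSpace ℝ (Fin m))) (g : Fin m → LipLoc (EuclideanSpace ℝ (Fin m))),
        extended T (B.indicator (f.1 ∘ π)) (fun i => LipLoc.comp (g i) π hπ.isLipLoc) = ofDensity θ f g

/-- Locally integral currents: locally integer rectifiable, with locally integer rectifiable
boundary in case the dimension is positive. -/
def IsLocallyIntegral : {m : ℕ} → Functional Z m → Prop
  | 0, T => IsLocallyIntegerRectifiable T
  | _ + 1, T => IsLocallyIntegerRectifiable T ∧ IsLocallyIntegerRectifiable (boundary T)

/-- Convergence of a sequence of locally integral currents in the local flat topology. -/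
def TendstoLocalFlat (Ts : ℕ → Functional Z m) (T : Functional Z m) : Prop :=
  ∀ B : Set Z, IsBounded B → IsClosed B →
    ∃ S : ℕ → Functional Z (m + 1), (∀ j, IsLocallyIntegral (S j)) ∧
      Tendsto (fun j => massOn (T - Ts j - boundary (S j)) B + massOn (S j) B) atTop (𝓝 0)

end Functionals

end MetricCurrents

namespace MetricCurrents

/-! ### Lipschitz functions -/

section LipschitzFunctions

variable {Z : Type*} [MetricSpace Z]

/-! The two limits are compared through the spaces `X n`, since no space contains both `Z` and `Z'`.
Evaluating `T - Tₙ - ∂S` and `∂S` on a test tuple is controlled by the masses of `T - Tₙ - ∂S` and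
of `S`. Local flat convergence is therefore uniform over tuples with common bounds on the support,
the values and the Lipschitz constants (`TendstoLocalFlat.eventually_abs_sub_le`). A tuple on `Z`,
restricted to `X n`, extends to `Z'` with comparable bounds by McShane's lemma. Hence `T (f, π)` is
a limit of values of `T'` on transferred tuples (`exists_transfer`).

Fix a nonprincipal ultrafilter and let `z` correspond to `w` if some points `y n` of `X n` have
images converging to `z` in `Z` and to `w` in `Z'`. This relation preserves distances. A point of
`spt T` is a limit of points `y n`, and a transferred tuple that detects `T` near it bounds the mass
of `T'` near `φ' n (y n)` from below. In a bounded region all but little of the mass of `T'` sits on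
a compact set, so these points stay near compact sets; being bounded, they converge by completeness
along the ultrafilter, to a point of `spt T'` (`exists_tendsto_mem_spt`). By symmetry the relation
is a surjective isometry `ψ`.

Finally, `T' (f, π)` is a limit of `T (Fₙ, Pₙ)`, where the transferred functions converge to `f ∘ ψ`
and `π ∘ ψ` pointwise on `spt T`. On equi-Lipschitz tuples with common bounds, `T` is continuous for
this convergence, because again only compact parts of `spt T` matter
(`IsLocallyIntegerRectifiable.exists_abs_sub_le`). So the limit is also the value of `T` at any
extension of these functions (`eq_of_correspondence`). -/

theorem tsupport_subset_of_eq_zero {f g : Z → ℝ} (h : ∀ z, f z = 0 → g z = 0) :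
    tsupport g ⊆ tsupport f := closure_mono fun z hz h0 => hz (h z h0)

theorem LipBS.isLipLoc (f : LipBS Z) : IsLipLoc f.1 := (LipBS.toLipLoc f).2

/-- A function of bounded support that is Lipschitz on bounded sets, as an element of `LipBS Z`. -/
def LipBS.ofLipLoc (f : Z → ℝ) (hf : IsLipLoc f) (hs : IsBounded (tsupport f)) : LipBS Z :=
  ⟨f, hf.exists_lipschitzWith hs, hs⟩

/-- The product of an element of `LipBS Z` with a function that is Lipschitz on bounded sets. -/
def LipBS.mulRight (f : LipBS Z) (g : Z → ℝ) (hg : IsLipLoc g) : LipBS Z :=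
  LipBS.ofLipLoc (f.1 * g) (IsLipLoc.mul (LipBS.isLipLoc f) hg)
    (f.2.2.subset (closure_mono (Function.support_mul_subset_left _ _)))

theorem LipBS.tsupport_mulRight_subset (f : LipBS Z) (g : Z → ℝ) (hg : IsLipLoc g) :
    tsupport (LipBS.mulRight f g hg).1 ⊆ tsupport f.1 :=
  closure_mono (Function.support_mul_subset_left _ _)

@[simp] theorem LipBS.mulRight_apply (f : LipBS Z) (g : Z → ℝ) (hg : IsLipLoc g) (z : Z) :
    (LipBS.mulRight f g hg).1 z = f.1 z * g z := rfl

/-- The truncation of a real number to `[-c, c]`. -/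
def clamp (c t : ℝ) : ℝ := max (-c) (min c t)

theorem abs_clamp_le {c : ℝ} (hc : 0 ≤ c) (t : ℝ) : |clamp c t| ≤ c :=
  abs_le.2 ⟨le_max_left _ _, max_le (by linarith) (min_le_left _ _)⟩

theorem clamp_eq_self {c t : ℝ} (h : |t| ≤ c) : clamp c t = t := by
  obtain ⟨h1, h2⟩ := abs_le.1 h
  rw [clamp, min_eq_right h2, max_eq_right h1]

theorem abs_sub_clamp_le {c : ℝ} (hc : 0 ≤ c) (t : ℝ) : |t - clamp c t| ≤ |t| := by
  rcases le_total |t| c with h | h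
  · rw [clamp_eq_self h]; simp
  · rcases le_total 0 t with h0 | h0
    · rw [abs_of_nonneg h0] at h ⊢
      rw [clamp, min_eq_left h, max_eq_right (by linarith), abs_of_nonneg (by linarith)]
      linarith
    · rw [abs_of_nonpos h0] at h ⊢
      rw [clamp, min_eq_right (by linarith), max_eq_left (by linarith), abs_of_nonpos (by linarith)]
      linarith

theorem lipschitzOnWith_clamp {g : Z → ℝ} {K : ℝ≥0} {A : Set Z} (hg : LipschitzOnWith K g A)
    (c : ℝ) : LipschitzOnWith K (fun z => clamp c (g z)) A := by
  rw [lipschitzOnWith_iff_restrict] at hg ⊢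
  exact (hg.const_min c).const_max (-c)

theorem lipschitzWith_clamp {g : Z → ℝ} {K : ℝ≥0} (hg : LipschitzWith K g) (c : ℝ) :
    LipschitzWith K (fun z => clamp c (g z)) :=
  (hg.const_min c).const_max (-c)

theorem IsLipLoc.clamp {g : Z → ℝ} (hg : IsLipLoc g) (c : ℝ) :
    IsLipLoc (fun z => clamp c (g z)) := fun A hA => by
  obtain ⟨K, hK⟩ := hg A hA
  exact ⟨K, lipschitzOnWith_clamp hK c⟩

theorem IsLipLoc.sub {f g : Z → ℝ} (hf : IsLipLoc f) (hg : IsLipLoc g) :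
    IsLipLoc (fun z => f z - g z) := (LipLoc Z).sub_mem hf hg

/-- A Lipschitz cut-off function between two concentric balls. -/
theorem exists_ball_cutoff (c : Z) {r t : ℝ} (ht : 0 < t) :
    ∃ σ : LipBS Z, (∀ z ∈ Metric.closedBall c r, σ.1 z = 1) ∧ (∀ z, 0 ≤ σ.1 z) ∧
      (∀ z, σ.1 z ≤ 1) ∧ tsupport σ.1 ⊆ Metric.closedBall c (r + t) ∧
      LipschitzWith (Real.toNNReal t⁻¹) σ.1 := by
  have hl : LipschitzWith (Real.toNNReal t⁻¹)
      fun z => max 0 (min 1 (t⁻¹ * (r + t - dist z c))) := by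
    refine LipschitzWith.const_max (LipschitzWith.const_min ?_ 1) 0
    refine LipschitzWith.of_dist_le_mul fun x y => ?_
    rw [Real.dist_eq, ← mul_sub, abs_mul, abs_of_pos (inv_pos.2 ht),
      Real.coe_toNNReal _ (inv_pos.2 ht).le]
    gcongr
    rw [show r + t - dist x c - (r + t - dist y c) = -(dist x c - dist y c) by ring, abs_neg]
    exact abs_dist_sub_le x y c
  have hs : tsupport (fun z => max 0 (min 1 (t⁻¹ * (r + t - dist z c)))) ⊆
      Metric.closedBall c (r + t) := by
    refine closure_minimal (fun z hz => ?_) Metric.isClosed_closedBall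
    by_contra h
    rw [Metric.mem_closedBall, not_le] at h
    refine hz (max_eq_left ((min_le_right _ _).trans ?_))
    exact mul_nonpos_of_nonneg_of_nonpos (inv_pos.2 ht).le (by linarith)
  refine ⟨⟨_, ⟨_, hl⟩, Metric.isBounded_closedBall.subset hs⟩, fun z hz => ?_, fun z => ?_,
    fun z => ?_, hs, hl⟩
  · have h1 : 1 ≤ t⁻¹ * (r + t - dist z c) := by
      rw [inv_mul_eq_div, le_div_iff₀ ht]
      linarith [Metric.mem_closedBall.1 hz]
    simp only
    rw [min_eq_left h1, max_eq_right zero_le_one]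
  · exact le_max_left _ _
  · exact max_le zero_le_one (min_le_left _ _)

/-- On a bounded set a function in `LipLoc Z` agrees with a globally Lipschitz function. -/
theorem LipLoc.exists_lipschitzWith_eqOn (g : LipLoc Z) {A : Set Z} (hA : IsBounded A) :
    ∃ (K : ℝ≥0) (G : LipLoc Z), LipschitzWith K G.1 ∧ ∀ z ∈ A, G.1 z = g.1 z := by
  obtain ⟨K, hK⟩ := g.2 A hA
  obtain ⟨G, hG, hGg⟩ := hK.extend_real
  exact ⟨K, ⟨G, hG.isLipLoc⟩, hG, fun z hz => (hGg hz).symm⟩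

theorem exists_lipschitzWith_eqOn_pi {m : ℕ} (π : Fin m → LipLoc Z) {A : Set Z}
    (hA : IsBounded A) : ∃ (K : ℝ≥0) (π' : Fin m → LipLoc Z),
      (∀ i, LipschitzWith K (π' i).1) ∧ ∀ i, ∀ z ∈ A, (π' i).1 z = (π i).1 z := by
  choose K G hG hGg using fun i => LipLoc.exists_lipschitzWith_eqOn (π i) hA
  exact ⟨∑ i, K i, G, fun i => (hG i).weaken
    (Finset.single_le_sum (f := K) (fun _ _ => zero_le) (Finset.mem_univ i)), hGg⟩

end LipschitzFunctions

/-! ### Multilinear and local functionals -/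

section Functionals

variable {Z : Type*} [MetricSpace Z] {m : ℕ} {T : Functional Z m}

/-- The multilinear map given by the last `m` arguments of a multilinear functional. -/
def IsMultilinear.toMultilinearMap (hT : IsMultilinear T) (f : LipBS Z) :
    MultilinearMap ℝ (fun _ : Fin m => LipLoc Z) ℝ :=
  MultilinearMap.mk' (T f) (fun π i g h => (hT.2 f π i).map_add g h)
    (fun π i c g => (hT.2 f π i).map_smul c g)

theorem IsMultilinear.smul_smul (hT : IsMultilinear T) (a b : ℝ) (f : LipBS Z)
    (π : Fin m → LipLoc Z) : T (a • f) (fun i => b • π i) = a * b ^ m * T f π := by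
  have h1 := (hT.toMultilinearMap (a • f)).map_smul_univ (fun _ => b) π
  have h2 := (hT.1 π).map_smul a f
  simp only [Finset.prod_const, Finset.card_univ, Fintype.card_fin, smul_eq_mul] at h1 h2
  change T (a • f) _ = b ^ m * T (a • f) π at h1
  rw [h1, h2]; ring

theorem IsMultilinear.map_sub (hT : IsMultilinear T) (f g : LipBS Z) (π : Fin m → LipLoc Z) :
    T (f - g) π = T f π - T g π := (hT.1 π).map_sub f g

theorem IsMultilinear.map_add (hT : IsMultilinear T) (f g : LipBS Z) (π : Fin m → LipLoc Z) :
    T (f + g) π = T f π + T g π := (hT.1 π).map_add f g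

theorem IsMultilinear.sub {S : Functional Z m} (hT : IsMultilinear T) (hS : IsMultilinear S) :
    IsMultilinear (T - S) := by
  refine ⟨fun π => ⟨fun f g => ?_, fun c f => ?_⟩, fun f π i => ⟨fun g h => ?_, fun c g => ?_⟩⟩
  · have h1 := (hT.1 π).map_add f g
    have h2 := (hS.1 π).map_add f g
    simp only [Pi.sub_apply] at h1 h2 ⊢
    rw [h1, h2]; ring
  · have h1 := (hT.1 π).map_smul c f
    have h2 := (hS.1 π).map_smul c f
    simp only [Pi.sub_apply, smul_eq_mul] at h1 h2 ⊢
    rw [h1, h2]; ring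
  · have h1 := (hT.2 f π i).map_add g h
    have h2 := (hS.2 f π i).map_add g h
    simp only [Pi.sub_apply] at h1 h2 ⊢
    rw [h1, h2]; ring
  · have h1 := (hT.2 f π i).map_smul c g
    have h2 := (hS.2 f π i).map_smul c g
    simp only [Pi.sub_apply, smul_eq_mul] at h1 h2 ⊢
    rw [h1, h2]; ring

theorem IsMultilinear.pushforward {Z' : Type*} [MetricSpace Z'] (hT : IsMultilinear T)
    {φ : Z → Z'} (hφ : IsAdmissible φ) : IsMultilinear (pushforward T φ hφ) := by
  have key : ∀ (π : Fin m → LipLoc Z') (i : Fin m) (g : LipLoc Z'),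
      (fun j => LipLoc.comp (Function.update π i g j) φ hφ.isLipLoc) =
        Function.update (fun j => LipLoc.comp (π j) φ hφ.isLipLoc) i
          (LipLoc.comp g φ hφ.isLipLoc) := by
    intro π i g
    funext j
    rcases eq_or_ne j i with rfl | h
    · simp
    · simp [h]
  refine ⟨fun π => ⟨fun f g => ?_, fun c f => ?_⟩, fun f π i => ⟨fun g h => ?_, fun c g => ?_⟩⟩
  · exact (hT.1 _).map_add (LipBS.comp f φ hφ) (LipBS.comp g φ hφ)
  · exact (hT.1 _).map_smul c (LipBS.comp f φ hφ)
  · simp only [MetricCurrents.pushforward, key]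
    exact (hT.2 _ _ i).map_add (LipLoc.comp g φ hφ.isLipLoc) (LipLoc.comp h φ hφ.isLipLoc)
  · simp only [MetricCurrents.pushforward, key]
    exact (hT.2 _ _ i).map_smul c (LipLoc.comp g φ hφ.isLipLoc)

/-- Strict locality: it suffices that one of the last arguments vanishes on the support of the
first one. -/
theorem IsMetricFunctional.eq_zero_of_eqOn_zero (hT : IsMetricFunctional T) {f : LipBS Z}
    {π : Fin m → LipLoc Z} (i : Fin m) (h : ∀ z ∈ tsupport f.1, (π i).1 z = 0) : T f π = 0 := by
  have hτ : ∀ c : ℝ, IsLipLoc (fun z => (π i).1 z - clamp c ((π i).1 z)) := fun c =>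
    IsLipLoc.sub (π i).2 (IsLipLoc.clamp (π i).2 c)
  let c : ℕ → ℝ := fun j => 1 / ((j : ℝ) + 1)
  have hc : ∀ j, 0 < c j := fun j => by positivity
  -- Subtracting the truncation at height `c j` gives a function vanishing wherever `|π i| ≤ c j`,
  -- hence on a neighbourhood of `spt f`, where locality applies. As `c j → 0` these functions tend
  -- to `π i`, with Lipschitz constants at most doubled.
  let πs : ℕ → Fin m → LipLoc Z := fun j => Function.update π i ⟨_, hτ (c j)⟩
  have hconv : Tendsto (fun j => T f (πs j)) atTop (𝓝 (T f π)) := by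
    refine hT.continuous f π πs (fun k z => ?_) fun A hA => ?_
    · rcases eq_or_ne k i with rfl | hk
      · have h0 : Tendsto (fun j => clamp (c j) ((π k).1 z)) atTop (𝓝 0) :=
          squeeze_zero_norm (fun j => abs_clamp_le (hc j).le _)
            tendsto_one_div_add_atTop_nhds_zero_nat
        simpa [πs] using h0.const_sub ((π k).1 z)
      · simp [πs, hk]
    · choose K hK using fun k => (π k).2 A hA
      refine ⟨∑ k, K k + ∑ k, K k, fun j k => ?_⟩
      have hle : ∀ k, K k ≤ ∑ k, K k := fun k =>
        Finset.single_le_sum (f := K) (fun _ _ => zero_le) (Finset.mem_univ k)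
      rcases eq_or_ne k i with rfl | hk
      · have := (hK k).sub (lipschitzOnWith_clamp (hK k) (c j))
        simpa [πs] using this.weaken (add_le_add (hle k) (hle k))
      · simpa [πs, hk] using (hK k).weaken ((hle k).trans le_self_add)
  have hzero : ∀ j, T f (πs j) = 0 := by
    intro j
    obtain ⟨K, hK⟩ := (π i).2 _ (f.2.2.thickening (δ := 1))
    have hK0 : (0 : ℝ) ≤ K := K.2
    -- Within distance `δ` of `spt f`, the `K`-Lipschitz function `π i` stays below `K * δ ≤ c j` in
    -- absolute value.
    set δ : ℝ := min 1 (c j / (K + 1)) with hδ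
    have hδ0 : 0 < δ := lt_min one_pos (div_pos (hc j) (by linarith))
    refine hT.isLocal f _ ⟨i, δ / 2, by linarith, 0, fun z hz => ?_⟩
    obtain ⟨w, hw, hzw⟩ := Metric.mem_thickening_iff.1
      (Metric.cthickening_subset_thickening' hδ0 (by linarith) _ hz)
    have hz1 : z ∈ Metric.thickening 1 (tsupport f.1) :=
      Metric.mem_thickening_iff.2 ⟨w, hw, hzw.trans_le (min_le_left _ _)⟩
    have hd := hK.dist_le_mul z hz1 w (Metric.self_subset_thickening one_pos _ hw)
    rw [h w hw, Real.dist_eq, sub_zero] at hd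
    have hzw' : dist z w ≤ c j / (K + 1) := hzw.le.trans (min_le_right _ _)
    rw [le_div_iff₀ (by linarith)] at hzw'
    have hle : |(π i).1 z| ≤ c j := by nlinarith [dist_nonneg (x := z) (y := w)]
    simp [πs, clamp_eq_self hle]
  simp only [hzero] at hconv
  exact tendsto_nhds_unique hconv tendsto_const_nhds

/-- The arguments are exchanged one at a time; each exchange changes the value by a term with one
argument vanishing on `spt f`, which is zero by strict locality. -/
theorem IsMetricFunctional.congr_of_eqOn (hT : IsMetricFunctional T) {f : LipBS Z}
    {π π' : Fin m → LipLoc Z} (h : ∀ i, ∀ z ∈ tsupport f.1, (π i).1 z = (π' i).1 z) :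
    T f π = T f π' := by
  have key : ∀ s : Finset (Fin m), T f (s.piecewise π' π) = T f π := by
    intro s
    induction s using Finset.induction_on with
    | empty => simp
    | insert i s hi ih =>
      rw [Finset.piecewise_insert, ← ih]
      have h1 := (hT.multilinear.2 f (s.piecewise π' π) i).map_sub (π' i) (π i)
      have h2 : Function.update (s.piecewise π' π) i (π i) = s.piecewise π' π := by
        conv_rhs => rw [← Function.update_eq_self i (s.piecewise π' π)]
        rw [Finset.piecewise_eq_of_notMem _ _ _ hi]
      rw [h2] at h1
      rw [← sub_eq_zero, ← h1]
      refine hT.eq_zero_of_eqOn_zero i fun z hz => ?_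
      simp [h i z hz]
  simpa using (key Finset.univ).symm

/-- The boundary does not depend on the cut-off function used to define it. -/
theorem boundary_eq {S : Functional Z (m + 1)} (hS : IsMetricFunctional S) (f : LipBS Z)
    (π : Fin m → LipLoc Z) {σ : LipBS Z} (hσ : ∀ z ∈ tsupport f.1, σ.1 z = 1) :
    boundary S f π = S σ (Fin.cons (LipBS.toLipLoc f) π : Fin (m + 1) → LipLoc Z) := by
  rw [boundary, ← sub_eq_zero, ← hS.multilinear.map_sub]
  refine hS.eq_zero_of_eqOn_zero 0 fun z hz => ?_
  set τ := (exists_cutoff f.2.2).choose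
  have hτ := (exists_cutoff f.2.2).choose_spec
  -- Two cut-offs differ only where `f = 0`. This set is closed, so it contains the support of their
  -- difference, and `f` now occupies the slot to which strict locality is applied.
  have hclosed : IsClosed {z | f.1 z = 0} :=
    isClosed_eq f.2.1.choose_spec.continuous continuous_const
  refine closure_minimal (fun w hw => ?_) hclosed hz
  by_contra h
  have hwf : w ∈ tsupport f.1 := subset_tsupport _ h
  refine hw ?_
  change τ.1 w - σ.1 w = 0
  rw [hτ w hwf, hσ w hwf, sub_self]

theorem IsMetricFunctional.isMultilinear_boundary {S : Functional Z (m + 1)}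
    (hS : IsMetricFunctional S) : IsMultilinear (boundary S) := by
  refine ⟨fun π => ⟨fun f g => ?_, fun c f => ?_⟩, fun f π i => ⟨fun g h => ?_, fun c g => ?_⟩⟩
  · obtain ⟨σ, hσ⟩ := exists_cutoff (f.2.2.union g.2.2)
    rw [boundary_eq hS f π fun z hz => hσ z (Or.inl hz),
      boundary_eq hS g π fun z hz => hσ z (Or.inr hz),
      boundary_eq hS (f + g) π fun z hz => hσ z (tsupport_add f.1 g.1 hz)]
    have := (hS.multilinear.2 σ (Fin.cons 0 π : Fin (m + 1) → LipLoc Z) 0).map_add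
      (LipBS.toLipLoc f) (LipBS.toLipLoc g)
    simp only [Fin.update_cons_zero] at this
    exact this
  · obtain ⟨σ, hσ⟩ := exists_cutoff f.2.2
    rw [boundary_eq hS f π hσ, boundary_eq hS (c • f) π fun z hz =>
      hσ z (closure_mono (Function.support_const_smul_subset c f.1) hz)]
    have := (hS.multilinear.2 σ (Fin.cons 0 π : Fin (m + 1) → LipLoc Z) 0).map_smul c
      (LipBS.toLipLoc f)
    simp only [Fin.update_cons_zero] at this
    exact this
  · simp only [boundary, Fin.cons_update]
    exact (hS.multilinear.2 _ _ i.succ).map_add g h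
  · simp only [boundary, Fin.cons_update]
    exact (hS.multilinear.2 _ _ i.succ).map_smul c g

end Functionals

/-! ### Mass and support -/

section Mass

variable {Z : Type*} [MetricSpace Z] {m : ℕ} {T : Functional Z m}

theorem mass_mono {V W : Set Z} (h : V ⊆ W) : mass T V ≤ mass T W := by
  refine iSup_mono fun k => iSup_mono fun f => iSup_mono fun π => iSup_mono fun h1 => ?_
  exact iSup_le fun h2 => le_iSup_of_le (fun l => (h2 l).trans h) le_rfl

theorem mass_le_massOn {V B : Set Z} (h : V ⊆ B) : mass T V ≤ massOn T B :=
  le_iInf fun _ => le_iInf fun _ => le_iInf fun hB => mass_mono (h.trans hB)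

theorem massOn_le_mass {V B : Set Z} (hV : IsOpen V) (h : B ⊆ V) : massOn T B ≤ mass T V :=
  iInf_le_of_le V (iInf_le_of_le hV (iInf_le_of_le h le_rfl))

theorem ofReal_le_mass {V : Set Z} {f : LipBS Z} {π : Fin m → LipLoc Z}
    (hf : tsupport f.1 ⊆ V) (hf1 : ∀ z, |f.1 z| ≤ 1) (hπ : ∀ i, LipschitzWith 1 (π i).1) :
    ENNReal.ofReal (T f π) ≤ mass T V := by
  refine le_iSup_of_le 1 <| le_iSup_of_le (fun _ => f) <| le_iSup_of_le (fun _ => π) <|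
    le_iSup_of_le (fun _ => hπ) <| le_iSup_of_le (fun _ => hf) <|
    le_iSup_of_le (fun z => ?_) ?_
  · simpa using hf1 z
  · simp

/-- Mass tests only functions bounded by `1` and `1`-Lipschitz arguments; the factor `M * L ^ m`
comes from rescaling by homogeneity. -/
theorem IsMultilinear.abs_le_of_mass_le (hT : IsMultilinear T) {V : Set Z} {a : ℝ} (ha : 0 ≤ a)
    (hV : mass T V ≤ ENNReal.ofReal a) {f : LipBS Z} {π : Fin m → LipLoc Z}
    (hf : tsupport f.1 ⊆ V) {M : ℝ} (hM : 0 < M) (hfM : ∀ z, |f.1 z| ≤ M) {L : ℝ≥0} (hL : 0 < L)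
    (hπ : ∀ i, LipschitzWith L (π i).1) : |T f π| ≤ M * L ^ m * a := by
  have hL' : (0 : ℝ) < L := hL
  -- Mass bounds values from above only; the sign `s = ±1` gives both inequalities.
  have key : ∀ s : ℝ, |s| = 1 → s * T f π ≤ M * L ^ m * a := by
    intro s hs
    have h1 : ENNReal.ofReal (T ((s * M⁻¹) • f) fun i => (L : ℝ)⁻¹ • π i) ≤ ENNReal.ofReal a := by
      refine (ofReal_le_mass ?_ (fun z => ?_) fun i => ?_).trans hV
      · exact (closure_mono (Function.support_const_smul_subset _ f.1)).trans hf
      · change |s * M⁻¹ * f.1 z| ≤ 1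
        rw [abs_mul, abs_mul, hs, abs_of_pos (inv_pos.2 hM), one_mul, inv_mul_le_one₀ hM]
        exact hfM z
      · refine LipschitzWith.of_dist_le_mul fun x y => ?_
        change dist ((L : ℝ)⁻¹ * (π i).1 x) ((L : ℝ)⁻¹ * (π i).1 y) ≤ _
        rw [Real.dist_eq, ← mul_sub, abs_mul, abs_of_pos (inv_pos.2 hL'), inv_mul_le_iff₀ hL',
          NNReal.coe_one, one_mul]
        exact (hπ i).dist_le_mul x y
    rw [ENNReal.ofReal_le_ofReal_iff ha, hT.smul_smul] at h1
    have h2 : s * M⁻¹ * (L : ℝ)⁻¹ ^ m * T f π = (s * T f π) / (M * L ^ m) := by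
      rw [inv_pow]; field_simp
    rw [h2, div_le_iff₀ (by positivity)] at h1
    linarith
  have h1 := key 1 (by simp)
  have h2 := key (-1) (by simp)
  exact abs_le.2 ⟨by linarith, by linarith⟩

theorem exists_ne_zero_of_mem_spt {z : Z} (hz : z ∈ spt T) {r : ℝ} (hr : 0 < r) :
    ∃ (f : LipBS Z) (π : Fin m → LipLoc Z), tsupport f.1 ⊆ Metric.ball z r ∧
      (∀ w, |f.1 w| ≤ 1) ∧ (∀ i, LipschitzWith 1 (π i).1) ∧ T f π ≠ 0 := by
  by_contra! h
  have h1 : mass T (Metric.ball z r) ≤ 0 := by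
    refine iSup_le fun k => iSup_le fun f => iSup_le fun π => iSup_le fun h1 => iSup_le fun h2 =>
      iSup_le fun h3 => ?_
    rw [Finset.sum_eq_zero, ENNReal.ofReal_zero]
    intro l _
    refine h (f l) (π l) (h2 l) (fun w => ?_) (h1 l)
    exact (Finset.single_le_sum (f := fun l => |(f l).1 w|) (fun _ _ => abs_nonneg _)
      (Finset.mem_univ l)).trans (h3 w)
  refine (hz (r / 2) (by linarith)).not_ge (le_trans ?_ h1)
  exact massOn_le_mass Metric.isOpen_ball (Metric.closedBall_subset_ball (by linarith))

theorem exists_mass_ball_eq_zero_of_notMem_spt {z : Z} (hz : z ∉ spt T) :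
    ∃ r > (0 : ℝ), mass T (Metric.ball z r) = 0 := by
  simp only [spt, mem_ofPred_eq, not_forall, not_lt] at hz
  obtain ⟨r, hr, h⟩ := hz
  exact ⟨r, hr, le_antisymm ((mass_le_massOn Metric.ball_subset_closedBall).trans h) zero_le⟩

theorem IsMultilinear.eq_zero_of_mass_eq_zero (hT : IsMultilinear T) {V : Set Z}
    (hV : mass T V = 0) {f : LipBS Z} {π : Fin m → LipLoc Z} (hf : tsupport f.1 ⊆ V)
    {L : ℝ≥0} (hπ : ∀ i, LipschitzWith L (π i).1) : T f π = 0 := by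
  obtain ⟨M, hM⟩ := ((LipBS.isLipLoc f).isBounded_image f.2.2).exists_norm_le
  have hfM : ∀ z, |f.1 z| ≤ |M| + 1 := fun z => by
    by_cases hz : z ∈ tsupport f.1
    · exact (hM _ (mem_image_of_mem _ hz)).trans ((le_abs_self M).trans (by linarith))
    · rw [image_eq_zero_of_notMem_tsupport hz, abs_zero]; positivity
  have := hT.abs_le_of_mass_le le_rfl (by simp [hV]) hf (by positivity) hfM
    (L := L + 1) (by positivity) (fun i => (hπ i).weaken le_self_add)
  rw [mul_zero] at this
  exact abs_nonpos_iff.1 this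

/-- If `f` is small on `C`, then `T f π` is small as soon as `C` carries almost all the mass. -/
theorem IsMultilinear.abs_le_of_abs_le_on (hT : IsMultilinear T) {V C : Set Z} {a b : ℝ}
    (ha : 0 ≤ a) (hb : 0 ≤ b) (hV : mass T V ≤ ENNReal.ofReal a)
    (hC : mass T (V \ C) ≤ ENNReal.ofReal b) {f : LipBS Z} {π : Fin m → LipLoc Z}
    (hf : tsupport f.1 ⊆ V) {M : ℝ} (hM : 0 < M) (hfM : ∀ z, |f.1 z| ≤ M) {L : ℝ≥0} (hL : 0 < L)
    (hπ : ∀ i, LipschitzWith L (π i).1) {η : ℝ} (hη : 0 < η) (hfη : ∀ z ∈ C, |f.1 z| ≤ η) :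
    |T f π| ≤ (2 * η * a + M * b) * L ^ m := by
  have hcl : IsLipLoc fun z => clamp (2 * η) (f.1 z) := (LipBS.isLipLoc f).clamp _
  have hsub : Function.support (fun z => clamp (2 * η) (f.1 z)) ⊆ Function.support f.1 :=
    fun z hz h0 => hz (by simp only [h0]; exact clamp_eq_self (by simp; linarith))
  -- Truncation at `2 * η` rather than `η` leaves a gap: the remainder `f - f₁` is supported in the
  -- closed set `{2 * η ≤ |f|}`, which misses `C`.
  let f₁ : LipBS Z := LipBS.ofLipLoc _ hcl (f.2.2.subset (closure_mono hsub))
  have hf₁ : ∀ z, f₁.1 z = clamp (2 * η) (f.1 z) := fun z => rfl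
  have h1 : |T f₁ π| ≤ 2 * η * L ^ m * a :=
    hT.abs_le_of_mass_le ha hV (f := f₁) ((closure_mono hsub).trans hf) (by linarith)
      (fun z => abs_clamp_le (by linarith) _) hL hπ
  have hv : ∀ z, (f - f₁).1 z = f.1 z - clamp (2 * η) (f.1 z) := fun z => rfl
  have hcont : Continuous f.1 := f.2.1.choose_spec.continuous
  have h2 : |T (f - f₁) π| ≤ M * L ^ m * b := by
    refine hT.abs_le_of_mass_le hb hC (fun z hz => ⟨hf ?_, fun hzC => ?_⟩) hM (fun z => ?_) hL hπ
    · refine tsupport_subset_of_eq_zero (fun w h0 => ?_) hz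
      rw [hv, h0, clamp_eq_self (by simp; linarith), sub_zero]
    · have hcl : IsClosed {w | 2 * η ≤ |f.1 w|} := isClosed_le continuous_const hcont.abs
      have hz' : z ∈ {w | 2 * η ≤ |f.1 w|} := by
        refine closure_minimal (fun w hw => ?_) hcl hz
        by_contra h
        refine hw ?_
        rw [hv, clamp_eq_self (not_le.1 h).le, sub_self]
      have := hfη z hzC
      simp only [mem_ofPred_eq] at hz'
      linarith
    · rw [hv]
      exact (abs_sub_clamp_le (by linarith) _).trans (hfM z)
  have h3 : T f π = T f₁ π + T (f - f₁) π := by rw [hT.map_sub]; ring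
  rw [h3]
  refine (abs_add_le _ _).trans ?_
  linarith

/-- As `IsMultilinear.abs_le_of_abs_le_on`, for `f` that is only known to be small on the part of
the compact set `C` in the support of `T`. -/
theorem IsMultilinear.abs_le_of_abs_le_on_spt (hT : IsMultilinear T) {V C : Set Z} {a b : ℝ}
    (ha : 0 ≤ a) (hb : 0 ≤ b) (hV : mass T V ≤ ENNReal.ofReal a) (hCc : IsCompact C)
    (hC : mass T (V \ C) ≤ ENNReal.ofReal b) {f : LipBS Z} {π : Fin m → LipLoc Z}
    (hf : tsupport f.1 ⊆ V) {M : ℝ} (hM : 0 < M) (hfM : ∀ z, |f.1 z| ≤ M) {L : ℝ≥0} (hL : 0 < L)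
    (hπ : ∀ i, LipschitzWith L (π i).1) {η : ℝ} (hη : 0 < η)
    (hfη : ∀ z ∈ C ∩ spt T, |f.1 z| ≤ η) :
    |T f π| ≤ (4 * η * a + M * b) * L ^ m := by
  classical
  have hcont : Continuous f.1 := f.2.1.choose_spec.continuous
  -- The bad points of `C`, where `f` is large, lie off `spt T`. By compactness finitely many balls
  -- of zero mass cover them, and multiplying `f` by factors `1 - χ` removes them without changing
  -- the value of `T`.
  have hK : IsCompact (C ∩ {z | 2 * η ≤ |f.1 z|}) :=
    hCc.inter_right (isClosed_le continuous_const hcont.abs)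
  have hKs : ∀ z ∈ C ∩ {z | 2 * η ≤ |f.1 z|}, ∃ r > (0 : ℝ), mass T (Metric.ball z r) = 0 := by
    rintro z ⟨hzC, hz⟩
    refine exists_mass_ball_eq_zero_of_notMem_spt fun hs => ?_
    have := hfη z ⟨hzC, hs⟩
    simp only [mem_ofPred_eq] at hz
    linarith
  choose! r hr hmass using hKs
  obtain ⟨t, htK, hKt⟩ := hK.elim_nhds_subcover (fun z => Metric.closedBall z (r z / 4))
    fun z hz => Metric.closedBall_mem_nhds z (by linarith [hr z hz])
  have hχ : ∀ z ∈ t, ∃ χ : LipBS Z, (∀ w ∈ Metric.closedBall z (r z / 4), χ.1 w = 1) ∧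
      (∀ w, 0 ≤ χ.1 w) ∧ (∀ w, χ.1 w ≤ 1) ∧ tsupport χ.1 ⊆ Metric.ball z (r z) := by
    intro z hz
    obtain ⟨χ, h1, h2, h3, h4, -⟩ := exists_ball_cutoff z (r := r z / 4) (t := r z / 4)
      (by linarith [hr z (htK z hz)])
    exact ⟨χ, h1, h2, h3, h4.trans (Metric.closedBall_subset_ball (by linarith [hr z (htK z hz)]))⟩
  choose! χ hχ1 hχ0 hχle hχs using hχ
  have hg : ∀ s : Finset Z, s ⊆ t → ∃ g : LipBS Z, T g π = T f π ∧ tsupport g.1 ⊆ tsupport f.1 ∧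
      (∀ w, |g.1 w| ≤ |f.1 w|) ∧ ∀ z ∈ s, ∀ w ∈ Metric.closedBall z (r z / 4), g.1 w = 0 := by
    intro s
    induction s using Finset.induction_on with
    | empty => exact fun _ => ⟨f, rfl, subset_rfl, fun _ => le_rfl, by simp⟩
    | insert x s hxs ih =>
      intro hs
      obtain ⟨hx, hs⟩ := Finset.insert_subset_iff.1 hs
      obtain ⟨g, hg1, hg2, hg3, hg4⟩ := ih hs
      have hv : ∀ w, (g - LipBS.mulRight g (χ x).1 (LipBS.isLipLoc (χ x))).1 w =
          g.1 w * (1 - (χ x).1 w) := by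
        intro w
        change g.1 w - g.1 w * (χ x).1 w = _
        ring
      refine ⟨g - LipBS.mulRight g (χ x).1 (LipBS.isLipLoc (χ x)), ?_, ?_, fun w => ?_,
        fun z hz w hw => ?_⟩
      · have h0 := hT.eq_zero_of_mass_eq_zero (hmass x (htK x hx))
          (f := LipBS.mulRight g (χ x).1 (LipBS.isLipLoc (χ x)))
          ((closure_mono (Function.support_mul_subset_right _ _)).trans (hχs x hx)) hπ
        rw [hT.map_sub, hg1, h0, sub_zero]
      · refine Subset.trans (tsupport_subset_of_eq_zero fun w h0 => ?_) hg2
        rw [hv, h0, zero_mul]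
      · rw [hv, abs_mul]
        refine (mul_le_of_le_one_right (abs_nonneg _) ?_).trans (hg3 w)
        rw [abs_le]
        constructor <;> linarith [hχ0 x hx w, hχle x hx w]
      · rw [hv]
        rcases Finset.mem_insert.1 hz with rfl | hz
        · rw [hχ1 z hx w hw, sub_self, mul_zero]
        · rw [hg4 z hz w hw, zero_mul]
  obtain ⟨g, hg1, hg2, hg3, hg4⟩ := hg t subset_rfl
  rw [← hg1]
  refine (hT.abs_le_of_abs_le_on ha hb hV hC (hg2.trans hf) hM (fun z => (hg3 z).trans (hfM z)) hL
    hπ (η := 2 * η) (by linarith) fun z hz => ?_).trans_eq (by ring)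
  rcases le_total (2 * η) |f.1 z| with h | h
  · obtain ⟨x, hx, hzx⟩ := mem_iUnion₂.1 (hKt ⟨hz, h⟩)
    rw [hg4 x hx z hzx, abs_zero]; linarith
  · exact (hg3 z).trans h

end Mass

/-! ### Continuity with respect to the values on the support -/

section Continuity

variable {Z : Type*} [MetricSpace Z] {m : ℕ} {T : Functional Z m}

theorem exists_thickening_cutoff (D : Set Z) {δ : ℝ} (hδ : 0 < δ) :
    ∃ χ : Z → ℝ, IsLipLoc χ ∧ (∀ z, 0 ≤ χ z) ∧ (∀ z, χ z ≤ 1) ∧ (∀ z ∈ D, χ z = 1) ∧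
      ∀ z, z ∉ Metric.thickening δ D → χ z = 0 := by
  refine ⟨fun z => ((thickenedIndicator hδ D z : ℝ≥0) : ℝ), ?_, fun z => NNReal.coe_nonneg _,
    fun z => ?_, fun z hz => ?_, fun z hz => ?_⟩
  · refine LipschitzWith.isLipLoc (K := δ.toNNReal⁻¹) (LipschitzWith.of_dist_le_mul fun x y => ?_)
    have := (lipschitzWith_thickenedIndicator hδ D).dist_le_mul x y
    simpa [NNReal.dist_eq, Real.dist_eq] using this
  · exact_mod_cast thickenedIndicator_le_one hδ D z
  · simp [thickenedIndicator_one hδ D hz]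
  · simp [thickenedIndicator_zero hδ D hz]

theorem IsCompactRectifiable.isCompact {C : Set Z} (hC : IsCompactRectifiable m C) :
    IsCompact C := by
  obtain ⟨k, K, q, h, rfl⟩ := hC
  refine isCompact_iUnion fun l => (h l).1.image_of_continuousOn ?_
  obtain ⟨L, hL⟩ := (h l).2
  exact hL.continuousOn

/-- Counterexamples for `δ = 1 / (j + 1)` would form an equi-Lipschitz sequence converging to `π`,
against the continuity axiom. -/
theorem IsMetricFunctional.exists_abs_sub_le_of_uniform (hT : IsMetricFunctional T) (f : LipBS Z)
    (π : Fin m → LipLoc Z) (L : ℝ≥0) {ε : ℝ} (hε : 0 < ε) :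
    ∃ δ > (0 : ℝ), ∀ π' : Fin m → LipLoc Z, (∀ i, LipschitzWith L (π' i).1) →
      (∀ i z, |(π' i).1 z - (π i).1 z| ≤ δ) → |T f π' - T f π| ≤ ε := by
  by_contra! h
  choose πs hL hδ hge using fun j : ℕ => h (1 / ((j : ℝ) + 1)) (by positivity)
  have hconv : Tendsto (fun j => T f (πs j)) atTop (𝓝 (T f π)) := by
    refine hT.continuous f π πs (fun i z => ?_) fun A _ => ⟨L, fun j i => (hL j i).lipschitzOnWith⟩
    rw [tendsto_iff_dist_tendsto_zero]
    exact squeeze_zero (fun _ => dist_nonneg) (fun j => hδ j i z)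
      tendsto_one_div_add_atTop_nhds_zero_nat
  obtain ⟨j, hj⟩ := (Metric.tendsto_nhds.1 hconv ε hε).exists
  exact (hge j).not_gt hj

/-- For Lipschitz arguments, `T f π` depends continuously on the restrictions of `f` and `π` to
the support of `T`, with respect to uniform convergence on compact sets. -/
theorem IsLocallyIntegerRectifiable.exists_abs_sub_le (hT : IsLocallyIntegerRectifiable T)
    {V : Set Z} (hVo : IsOpen V) (hVb : IsBounded V) {f : LipBS Z} {π : Fin m → LipLoc Z}
    (hf : tsupport f.1 ⊆ V) {M : ℝ} (hM : 0 < M) (hfM : ∀ z, |f.1 z| ≤ M) {L : ℝ≥0} (hL : 0 < L)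
    (hπ : ∀ i, LipschitzWith L (π i).1) {ε : ℝ} (hε : 0 < ε) :
    ∃ C ⊆ V, IsCompact C ∧ ∃ δ > (0 : ℝ), ∀ (f' : LipBS Z) (π' : Fin m → LipLoc Z),
      tsupport f'.1 ⊆ V → (∀ z, |f'.1 z| ≤ M) → (∀ i, LipschitzWith L (π' i).1) →
      (∀ z ∈ C ∩ spt T, |f'.1 z - f.1 z| ≤ δ ∧ ∀ i, |(π' i).1 z - (π i).1 z| ≤ δ) →
      |T f' π' - T f π| ≤ ε := by
  have hmf := hT.isMetricFunctional
  have hml := hmf.multilinear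
  have hL0 : (0 : ℝ) < L := hL
  -- The intermediate arguments `Q` below are `3 * L`-Lipschitz, whence the factor `A`. The numbers
  -- `b` and `δ` make the mass errors `12 * δ * a * A` and `4 * M * b * A` at most `ε / 4` each;
  -- continuity uses the remaining `ε / 2`.
  set A : ℝ := (3 * L : ℝ≥0) ^ m with hA
  have hA0 : 0 < A := by positivity
  set b : ℝ := ε / (16 * M * A) with hb
  have hb0 : 0 < b := by positivity
  obtain ⟨C, hCV, hCr, hVfin, hCε⟩ := hT.rectifiable V hVo hVb (ENNReal.ofReal b)
    (ENNReal.ofReal_pos.2 hb0)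
  have hCc : IsCompact C := hCr.isCompact
  set a : ℝ := (mass T V).toReal with ha
  have ha0 : 0 ≤ a := ENNReal.toReal_nonneg
  have hVa : mass T V ≤ ENNReal.ofReal a := (ENNReal.ofReal_toReal hVfin.ne).ge
  obtain ⟨δ₁, hδ₁, hcont⟩ := hmf.exists_abs_sub_le_of_uniform f π (3 * L) (half_pos hε)
  set δ : ℝ := min (δ₁ / 2) (ε / (48 * (a + 1) * A)) with hδ
  have hδ0 : 0 < δ := lt_min (by linarith) (by positivity)
  have hδ1 : 2 * δ ≤ δ₁ := by linarith [min_le_left (δ₁ / 2) (ε / (48 * (a + 1) * A))]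
  have hδ2 : 12 * δ * a * A ≤ ε / 4 := by
    have h := min_le_right (δ₁ / 2) (ε / (48 * (a + 1) * A))
    rw [← hδ, le_div_iff₀ (by positivity)] at h
    have := mul_pos hδ0 hA0
    nlinarith
  have hbA : 4 * M * b * A = ε / 4 := by
    rw [hb]; field_simp; ring
  refine ⟨C, hCV, hCc, δ, hδ0, fun f' π' hf' hfM' hπ' hclose => ?_⟩
  have hL3 : (0 : ℝ≥0) < 3 * L := by positivity
  have hle3 : L ≤ 3 * L := le_mul_of_one_le_left zero_le (by norm_num)
  have hπ3 : ∀ i, LipschitzWith (3 * L) (π' i).1 := fun i => (hπ' i).weaken hle3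
  have h1 : |T (f' - f) π'| ≤ (4 * δ * a + 2 * M * b) * A := by
    refine hml.abs_le_of_abs_le_on_spt ha0 hb0.le hVa hCc hCε.le ?_ (by linarith) (fun z => ?_)
      hL3 hπ3 hδ0 fun z hz => (hclose z hz).1
    · exact (tsupport_sub f'.1 f.1).trans (union_subset hf' hf)
    · exact (abs_sub _ _).trans (by linarith [hfM z, hfM' z])
  have hdiff : ∀ i, LipschitzWith (L + L) fun z => (π' i).1 z - (π i).1 z :=
    fun i => (hπ' i).sub (hπ i)
  have hQ : ∀ i, LipschitzWith (3 * L)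
      fun z => (π i).1 z + clamp (2 * δ) ((π' i).1 z - (π i).1 z) := fun i => by
    have := (hπ i).add (lipschitzWith_clamp (hdiff i) (2 * δ))
    rwa [show L + (L + L) = 3 * L by ring] at this
  -- `Q` interpolates between `π` and `π'`: it is uniformly within `2 * δ` of `π`, and equals `π'`
  -- near `C ∩ spt T`.
  let Q : Fin m → LipLoc Z := fun i => ⟨_, (hQ i).isLipLoc⟩
  have h4 : |T f Q - T f π| ≤ ε / 2 := by
    refine hcont Q hQ fun i z => ?_
    have : (Q i).1 z - (π i).1 z = clamp (2 * δ) ((π' i).1 z - (π i).1 z) := by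
      simp [Q]
    rw [this]
    exact (abs_clamp_le (by linarith) _).trans hδ1
  -- On `C ∩ spt T` the difference `π' - π` is at most `δ`, and it is `2 * L`-Lipschitz, so it stays
  -- below `2 * δ` on a thickening of width `δ / (2 * L)`. There the truncation in `Q` is inactive.
  obtain ⟨χ, hχl, hχ0, hχ1, hχD, hχz⟩ := exists_thickening_cutoff (C ∩ spt T)
    (δ := δ / (2 * L)) (by positivity)
  set g := LipBS.mulRight f χ hχl with hg
  have hgQ : T g π' = T g Q := by
    refine hmf.congr_of_eqOn fun i z hz => ?_
    have hcl : IsClosed {w | |(π' i).1 w - (π i).1 w| ≤ 2 * δ} :=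
      isClosed_le (hdiff i).continuous.abs continuous_const
    have hz' : |(π' i).1 z - (π i).1 z| ≤ 2 * δ := by
      refine closure_minimal (fun w hw => ?_) hcl hz
      have hw' : w ∈ Metric.thickening (δ / (2 * L)) (C ∩ spt T) := by
        by_contra h
        exact hw (by simp [g, hχz w h])
      obtain ⟨v, hv, hvw⟩ := Metric.mem_thickening_iff.1 hw'
      have h5 := (hdiff i).dist_le_mul w v
      rw [lt_div_iff₀ (by positivity)] at hvw
      have h6 := (hclose v hv).2 i
      rw [Real.dist_eq] at h5
      push_cast at h5
      have h7 := abs_sub_abs_le_abs_sub ((π' i).1 w - (π i).1 w) ((π' i).1 v - (π i).1 v)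
      change |(π' i).1 w - (π i).1 w| ≤ 2 * δ
      linarith
    simp [Q, clamp_eq_self hz']
  have hfgv : ∀ z, (f - g).1 z = f.1 z * (1 - χ z) := fun z => by
    change f.1 z - f.1 z * χ z = _
    ring
  have hfgs : tsupport (f - g).1 ⊆ V :=
    (tsupport_subset_of_eq_zero fun z h0 => by rw [hfgv, h0, zero_mul]).trans hf
  have hfgM : ∀ z, |(f - g).1 z| ≤ M := fun z => by
    rw [hfgv, abs_mul]
    refine (mul_le_of_le_one_right (abs_nonneg _) ?_).trans (hfM z)
    rw [abs_le]
    constructor <;> linarith [hχ0 z, hχ1 z]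
  have hfgD : ∀ z ∈ C ∩ spt T, |(f - g).1 z| ≤ δ := fun z hz => by
    rw [hfgv, hχD z hz]; simpa using hδ0.le
  have h2 : |T (f - g) π'| ≤ (4 * δ * a + M * b) * A :=
    hml.abs_le_of_abs_le_on_spt ha0 hb0.le hVa hCc hCε.le hfgs hM hfgM hL3 hπ3 hδ0 hfgD
  have h3 : |T (f - g) Q| ≤ (4 * δ * a + M * b) * A :=
    hml.abs_le_of_abs_le_on_spt ha0 hb0.le hVa hCc hCε.le hfgs hM hfgM hL3 hQ hδ0 hfgD
  -- The part `g` of `f` near `C ∩ spt T` does not distinguish `π'` from `Q`; the rest `f - g`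
  -- vanishes on `C ∩ spt T`, so its contributions are small.
  have hsum : T f' π' - T f π =
      T (f' - f) π' + (T (f - g) π' - T (f - g) Q) + (T f Q - T f π) := by
    rw [hml.map_sub, hml.map_sub, hml.map_sub, hgQ]; ring
  rw [hsum]
  have e1 := abs_add_le (T (f' - f) π' + (T (f - g) π' - T (f - g) Q)) (T f Q - T f π)
  have e2 := abs_add_le (T (f' - f) π') (T (f - g) π' - T (f - g) Q)
  have e3 := abs_sub (T (f - g) π') (T (f - g) Q)
  linarith

/-- Pointwise convergence of equi-Lipschitz functions is uniform on totally bounded sets. -/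
theorem eventually_forall_abs_sub_le {ι : Type*} {l : Filter ι} {D : Set Z}
    (hD : TotallyBounded D) {F : ι → Z → ℝ} {G : Z → ℝ} {L : ℝ≥0}
    (hF : ∀ᶠ n in l, LipschitzWith L (F n))
    (hG : LipschitzWith L G) (h : ∀ z ∈ D, Tendsto (fun n => F n z) l (𝓝 (G z))) {δ : ℝ}
    (hδ : 0 < δ) : ∀ᶠ n in l, ∀ z ∈ D, |F n z - G z| ≤ δ := by
  -- The net is so fine that moving to a net point costs each of the two functions at most `δ / 4`.
  obtain ⟨t, htD, htf, hDt⟩ := Metric.finite_approx_of_totallyBounded hD (δ / (4 * (L + 1)))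
    (by positivity)
  have h1 : ∀ᶠ n in l, ∀ w ∈ t, |F n w - G w| < δ / 2 :=
    (htf.eventually_all).2 fun w hw => Metric.tendsto_nhds.1 (h w (htD hw)) _ (half_pos hδ)
  filter_upwards [h1, hF] with n hn hFn z hz
  obtain ⟨w, hw, hzw⟩ := mem_iUnion₂.1 (hDt hz)
  rw [Metric.mem_ball, lt_div_iff₀ (by positivity)] at hzw
  have e1 := hFn.dist_le_mul z w
  have e2 := hG.dist_le_mul z w
  rw [Real.dist_eq] at e1 e2
  have e3 := hn w hw
  rw [abs_le] at e1 e2 ⊢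
  rw [abs_lt] at e3
  have hd := dist_nonneg (x := z) (y := w)
  constructor <;> nlinarith

theorem IsLocallyIntegerRectifiable.tendsto {ι : Type*} {l : Filter ι}
    (hT : IsLocallyIntegerRectifiable T)
    {V : Set Z} (hVo : IsOpen V) (hVb : IsBounded V) {f : LipBS Z} {π : Fin m → LipLoc Z}
    (hf : tsupport f.1 ⊆ V) {M : ℝ} (hM : 0 < M) (hfM : ∀ z, |f.1 z| ≤ M) {L : ℝ≥0} (hL : 0 < L)
    (hfL : LipschitzWith L f.1) (hπ : ∀ i, LipschitzWith L (π i).1)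
    {fs : ι → LipBS Z} {πs : ι → Fin m → LipLoc Z}
    (hfs : ∀ᶠ n in l, tsupport (fs n).1 ⊆ V) (hfsM : ∀ᶠ n in l, ∀ z, |(fs n).1 z| ≤ M)
    (hfsL : ∀ᶠ n in l, LipschitzWith L (fs n).1)
    (hπs : ∀ᶠ n in l, ∀ i, LipschitzWith L (πs n i).1)
    (hlimf : ∀ z ∈ spt T ∩ V, Tendsto (fun n => (fs n).1 z) l (𝓝 (f.1 z)))
    (hlimπ : ∀ z ∈ spt T ∩ V, ∀ i, Tendsto (fun n => (πs n i).1 z) l (𝓝 ((π i).1 z))) :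
    Tendsto (fun n => T (fs n) (πs n)) l (𝓝 (T f π)) := by
  refine Metric.tendsto_nhds.2 fun ε hε => ?_
  obtain ⟨C, hCV, hC, δ, hδ, key⟩ := hT.exists_abs_sub_le hVo hVb hf hM hfM hL hπ (half_pos hε)
  have htb : TotallyBounded (C ∩ spt T) := hC.totallyBounded.subset inter_subset_left
  have h1 := eventually_forall_abs_sub_le htb hfsL hfL
    (fun z hz => hlimf z ⟨hz.2, hCV hz.1⟩) hδ
  have h2 : ∀ᶠ n in l, ∀ i, ∀ z ∈ C ∩ spt T, |(πs n i).1 z - (π i).1 z| ≤ δ :=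
    eventually_all.2 fun i => eventually_forall_abs_sub_le htb (hπs.mono fun n hn => hn i) (hπ i)
      (fun z hz => hlimπ z ⟨hz.2, hCV hz.1⟩ i) hδ
  filter_upwards [hfs, hfsM, hπs, h1, h2] with n e1 e2 e3 e4 e5
  rw [Real.dist_eq]
  exact (key _ _ e1 e2 e3 fun z hz => ⟨e4 z hz, fun i => e5 i z hz⟩).trans_lt (by linarith)

end Continuity

/-! ### Uniform convergence on test functions -/

section FlatConvergence

variable {Z : Type*} [MetricSpace Z] {m : ℕ} {T : Functional Z m} {Ts : ℕ → Functional Z m}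

theorem IsLocallyIntegral.isLocallyIntegerRectifiable (hT : IsLocallyIntegral T) :
    IsLocallyIntegerRectifiable T := by
  cases m with
  | zero => exact hT
  | succ m => exact hT.1

theorem IsLocallyIntegral.isMultilinear (hT : IsLocallyIntegral T) : IsMultilinear T :=
  hT.isLocallyIntegerRectifiable.isMetricFunctional.multilinear

/-- Local flat convergence implies uniform convergence on test functions with uniformly bounded
Lipschitz constants and supports. -/
theorem TendstoLocalFlat.eventually_abs_sub_le (h : TendstoLocalFlat Ts T)
    (hTs : ∀ n, IsMultilinear (Ts n)) (hT : IsMultilinear T) (p : Z) (R : ℝ) {M : ℝ} (hM : 0 < M)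
    {L : ℝ≥0} (hL : 0 < L) {ε : ℝ} (hε : 0 < ε) :
    ∀ᶠ n in atTop, ∀ (f : LipBS Z) (π : Fin m → LipLoc Z), tsupport f.1 ⊆ Metric.closedBall p R →
      (∀ z, |f.1 z| ≤ M) → LipschitzWith L f.1 → (∀ i, LipschitzWith L (π i).1) →
      |T f π - Ts n f π| ≤ ε := by
  obtain ⟨S, hS, hlim⟩ := h (Metric.closedBall p (R + 1)) Metric.isBounded_closedBall
    Metric.isClosed_closedBall
  have hL0 : (0 : ℝ) < L := hL
  -- In `∂S` the function `f` becomes one more Lipschitz argument and the cut-off, bounded by `1`,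
  -- takes its place; hence the term `1 * L ^ (m + 1)`. The cut-off also explains the radius `R +
  -- 1`.
  set c : ℝ := ε / (M * L ^ m + 1 * L ^ (m + 1)) with hc
  have hc0 : 0 < c := by positivity
  obtain ⟨σ, hσ1, hσ0, hσle, hσs, -⟩ := exists_ball_cutoff p (r := R) one_pos
  filter_upwards [hlim.eventually_lt_const (ENNReal.ofReal_pos.2 hc0)] with n hn f π hf hfM hfL hπ
  have hSm := (hS n).1.isMetricFunctional
  have h1 : |(T - Ts n - boundary (S n)) f π| ≤ M * L ^ m * c := by
    refine ((hT.sub (hTs n)).sub hSm.isMultilinear_boundary).abs_le_of_mass_le hc0.le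
      (V := Metric.closedBall p (R + 1)) ?_
      (hf.trans (Metric.closedBall_subset_closedBall (by linarith))) hM hfM hL hπ
    exact (mass_le_massOn subset_rfl).trans (le_self_add.trans hn.le)
  have h2 : |boundary (S n) f π| ≤ 1 * L ^ (m + 1) * c := by
    rw [boundary_eq hSm f π fun z hz => hσ1 z (hf hz)]
    refine hSm.multilinear.abs_le_of_mass_le hc0.le (V := Metric.closedBall p (R + 1)) ?_ hσs
      one_pos (fun z => abs_le.2 ⟨by linarith [hσ0 z], hσle z⟩) hL fun i => ?_
    · exact (mass_le_massOn subset_rfl).trans (le_add_self.trans hn.le)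
    · induction i using Fin.cases with
      | zero => exact hfL
      | succ i => exact hπ i
  have h3 : T f π - Ts n f π = (T - Ts n - boundary (S n)) f π + boundary (S n) f π := by
    simp only [Pi.sub_apply]; ring
  rw [h3]
  refine (abs_add_le _ _).trans ((add_le_add h1 h2).trans_eq ?_)
  rw [← add_mul, hc, mul_div_cancel₀]
  positivity

theorem LipBS.exists_bound (f : LipBS Z) : ∃ M : ℝ≥0, 0 < M ∧ ∀ z, |f.1 z| ≤ M := by
  obtain ⟨M, hM⟩ := ((LipBS.isLipLoc f).isBounded_image f.2.2).exists_norm_le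
  refine ⟨M.toNNReal + 1, by positivity, fun z => ?_⟩
  push_cast
  by_cases hz : z ∈ tsupport f.1
  · exact (hM _ (mem_image_of_mem _ hz)).trans (by linarith [Real.le_coe_toNNReal M])
  · rw [image_eq_zero_of_notMem_tsupport hz, abs_zero]; positivity

end FlatConvergence

/-! ### Extension along isometric embeddings -/

section Transfer

variable {X Z' : Type*} [MetricSpace X] [MetricSpace Z']

theorem _root_.Isometry.exists_lipschitzWith_extension {ι : X → Z'} (hι : Isometry ι) {g : X → ℝ}
    {K : ℝ≥0} (hg : LipschitzWith K g) :
    ∃ G : Z' → ℝ, LipschitzWith K G ∧ ∀ x, G (ι x) = g x := by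
  have hl : LipschitzOnWith K (Function.extend ι g 0) (range ι) := by
    rintro _ ⟨x, rfl⟩ _ ⟨y, rfl⟩
    rw [hι.injective.extend_apply, hι.injective.extend_apply, hι x y]
    exact hg x y
  obtain ⟨G, hG, hGg⟩ := hl.extend_real
  exact ⟨G, hG, fun x => by rw [← hGg (mem_range_self x), hι.injective.extend_apply]⟩

/-- A McShane extension is truncated to recover the bound `M` and multiplied by a cut-off of slope
`t⁻¹` to recover bounded support; the product rule gives the constant `K + M * t⁻¹`. -/
theorem _root_.Isometry.exists_lipBS_extension {ι : X → Z'} (hι : Isometry ι) {g : X → ℝ}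
    {K M t : ℝ≥0} (ht : 0 < t) (hg : LipschitzWith K g) (hM : ∀ x, |g x| ≤ M) {y : X} {ρ : ℝ}
    (hy : ∀ x, ρ < dist x y → g x = 0) :
    ∃ G : LipBS Z', LipschitzWith (K + M * t⁻¹) G.1 ∧ (∀ z, |G.1 z| ≤ M) ∧
      tsupport G.1 ⊆ Metric.closedBall (ι y) (ρ + t) ∧ ∀ x, G.1 (ι x) = g x := by
  obtain ⟨G₀, hG₀, hG₀g⟩ := hι.exists_lipschitzWith_extension hg
  obtain ⟨σ, hσ1, hσ0, hσle, hσs, hσl⟩ := exists_ball_cutoff (ι y) (r := ρ) (t := t) ht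
  have hσa : ∀ z, |σ.1 z| ≤ 1 := fun z => abs_le.2 ⟨by linarith [hσ0 z], hσle z⟩
  have hcl := lipschitzWith_clamp hG₀ M
  have hcM : ∀ z, |clamp M (G₀ z)| ≤ M := fun z => abs_clamp_le M.2 _
  refine ⟨LipBS.mulRight σ _ hcl.isLipLoc, LipschitzWith.of_dist_le_mul fun u v => ?_, fun z => ?_,
    (LipBS.tsupport_mulRight_subset _ _ _).trans hσs, fun x => ?_⟩
  · have e1 := hcl.dist_le_mul u v
    have e2 := hσl.dist_le_mul u v
    rw [Real.coe_toNNReal _ (by positivity)] at e2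
    rw [Real.dist_eq] at e1 e2 ⊢
    have h : (LipBS.mulRight σ _ hcl.isLipLoc).1 u - (LipBS.mulRight σ _ hcl.isLipLoc).1 v =
        σ.1 u * (clamp M (G₀ u) - clamp M (G₀ v)) + clamp M (G₀ v) * (σ.1 u - σ.1 v) := by
      simp only [LipBS.mulRight_apply]; ring
    rw [h]
    refine (abs_add_le _ _).trans ?_
    rw [abs_mul, abs_mul]
    have e3 := mul_le_mul (hσa u) e1 (abs_nonneg _) zero_le_one
    have e4 := mul_le_mul (hcM v) e2 (abs_nonneg _) M.2
    push_cast
    linarith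
  · rw [LipBS.mulRight_apply, abs_mul]
    exact (mul_le_mul (hσa z) (hcM z) (abs_nonneg _) zero_le_one).trans_eq (one_mul _)
  · rw [LipBS.mulRight_apply, hG₀g, clamp_eq_self (hM x)]
    rcases le_or_gt (dist x y) ρ with h | h
    · rw [hσ1 _ (by rwa [Metric.mem_closedBall, hι.dist_eq]), one_mul]
    · rw [hy x h, mul_zero]

end Transfer

/-! ### Comparison of limits of the same sequence in two spaces -/

section Comparison

variable {m : ℕ} {X : ℕ → Type*} [∀ n, MetricSpace (X n)] {x : ∀ n, X n}
  {Tn : ∀ n, Functional (X n) m}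
  {Z : Type*} [MetricSpace Z] {z₀ : Z} {Z' : Type*} [MetricSpace Z'] {z₀' : Z'}
  {φ : ∀ n, X n → Z} {hφ : ∀ n, Isometry (φ n)} {φ' : ∀ n, X n → Z'} {hφ' : ∀ n, Isometry (φ' n)}
  {T : Functional Z m} {T' : Functional Z' m}

/-- Test functions on `Z` can be transferred to `Z'` along the spaces `X n`. -/
theorem exists_transfer {l : Filter ℕ} (hl : l ≤ atTop) (hTn : ∀ n, IsMultilinear (Tn n))
    (hT : IsMultilinear T) (hT' : IsMultilinear T')
    (hconv : TendstoLocalFlat (fun n => pushforward (Tn n) (φ n) (hφ n).isAdmissible) T)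
    (hconv' : TendstoLocalFlat (fun n => pushforward (Tn n) (φ' n) (hφ' n).isAdmissible) T')
    {f : LipBS Z} {π : Fin m → LipLoc Z} {K M L t : ℝ≥0} (ht : 0 < t) (hM : 0 < M)
    (hfM : ∀ z, |f.1 z| ≤ M) (hfK : LipschitzWith K f.1) (hπ : ∀ i, LipschitzWith L (π i).1)
    {p : Z} {ρ : ℝ} (hf : tsupport f.1 ⊆ Metric.closedBall p ρ) {y : ∀ n, X n}
    (hy : Tendsto (fun n => φ n (y n)) l (𝓝 p)) {p' : Z'} {R : ℝ}
    (hy' : ∀ᶠ n in l, dist (φ' n (y n)) p' ≤ R) :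
    ∃ (f' : ℕ → LipBS Z') (π' : ℕ → Fin m → LipLoc Z'),
      (∀ n, LipschitzWith (K + M * t⁻¹) (f' n).1) ∧ (∀ n z, |(f' n).1 z| ≤ M) ∧
      (∀ n i, LipschitzWith L (π' n i).1) ∧
      (∀ᶠ n in l, tsupport (f' n).1 ⊆ Metric.closedBall (φ' n (y n)) (ρ + t + t)) ∧
      (∀ᶠ n in l, ∀ a, (f' n).1 (φ' n a) = f.1 (φ n a)) ∧
      (∀ n i a, (π' n i).1 (φ' n a) = (π i).1 (φ n a)) ∧
      Tendsto (fun n => T' (f' n) (π' n)) l (𝓝 (T f π)) := by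
  have hex : ∀ n, ∃ g : LipBS Z', LipschitzWith (K + M * t⁻¹) g.1 ∧ (∀ z, |g.1 z| ≤ M) ∧
      (dist (φ n (y n)) p < t → tsupport g.1 ⊆ Metric.closedBall (φ' n (y n)) (ρ + t + t) ∧
        ∀ a, g.1 (φ' n a) = f.1 (φ n a)) := by
    intro n
    by_cases hd : dist (φ n (y n)) p < t
    · have hg : LipschitzWith K (f.1 ∘ φ n) := by
        simpa using hfK.comp (hφ n).lipschitz
      obtain ⟨G, h1, h2, h3, h4⟩ := (hφ' n).exists_lipBS_extension ht hg (fun a => hfM _)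
        (y := y n) (ρ := ρ + t) fun a ha => by
          by_contra h0
          have h5 := Metric.mem_closedBall.1 (hf (subset_tsupport f.1 h0))
          have h6 := dist_triangle_right (φ n a) (φ n (y n)) p
          rw [(hφ n).dist_eq] at h6
          linarith
      exact ⟨G, h1, h2, fun _ => ⟨h3, h4⟩⟩
    -- For the remaining `n`, which are negligible along `l`, the zero function keeps the uniform
    -- bounds valid for every `n`.
    · exact ⟨0, LipschitzWith.const' 0, fun z => by simp, fun h => absurd h hd⟩
  choose f' hf'L hf'M hf' using hex
  have hexπ : ∀ n i, ∃ G : LipLoc Z', LipschitzWith L G.1 ∧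
      ∀ a, G.1 (φ' n a) = (π i).1 (φ n a) := fun n i => by
    obtain ⟨G, hG, hGg⟩ := (hφ' n).exists_lipschitzWith_extension
      (g := (π i).1 ∘ φ n) (K := L) (by simpa using (hπ i).comp (hφ n).lipschitz)
    exact ⟨⟨G, hG.isLipLoc⟩, hG, hGg⟩
  choose π' hπ'L hπ' using hexπ
  have hnear : ∀ᶠ n in l, dist (φ n (y n)) p < t := Metric.tendsto_nhds.1 hy t ht
  refine ⟨f', π', hf'L, hf'M, hπ'L, hnear.mono fun n hn => (hf' n hn).1,
    hnear.mono fun n hn => (hf' n hn).2, hπ', Metric.tendsto_nhds.2 fun ε hε => ?_⟩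
  set L₀ : ℝ≥0 := K + M * t⁻¹ + L + 1
  have hL₀ : 0 < L₀ := by positivity
  have h1 : K ≤ L₀ := by
    simp only [L₀, add_assoc]; exact le_self_add
  have h2 : K + M * t⁻¹ ≤ L₀ := by
    simp only [L₀]; rw [add_assoc (K + M * t⁻¹)]; exact le_self_add
  have h3 : L ≤ L₀ := by
    simp only [L₀]; rw [add_right_comm]; exact le_add_self
  have hM' : (0 : ℝ) < M := hM
  have e1 := hl (hconv.eventually_abs_sub_le (fun n => (hTn n).pushforward _) hT p ρ hM' hL₀
    (ε := ε / 3) (by linarith))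
  have e2 := hl (hconv'.eventually_abs_sub_le (fun n => (hTn n).pushforward _) hT' p'
    (ρ + t + t + R) hM' hL₀ (ε := ε / 3) (by linarith))
  filter_upwards [e1, e2, hnear, hy'] with n h4 h5 h6 h7
  have h8 := h4 f π hf hfM (hfK.weaken h1) fun i => (hπ i).weaken h3
  have h9 := h5 (f' n) (π' n)
    ((hf' n h6).1.trans (Metric.closedBall_subset_closedBall' (by linarith))) (hf'M n)
    ((hf'L n).weaken h2) fun i => (hπ'L n i).weaken h3
  -- Both push-forwards evaluate `Tn n` at the same tuple on `X n`; this equality links `Z` and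
  -- `Z'`.
  have h10 : pushforward (Tn n) (φ' n) (hφ' n).isAdmissible (f' n) (π' n) =
      pushforward (Tn n) (φ n) (hφ n).isAdmissible f π := by
    have ef : LipBS.comp (f' n) (φ' n) (hφ' n).isAdmissible =
        LipBS.comp f (φ n) (hφ n).isAdmissible := Subtype.ext (funext (hf' n h6).2)
    have eπ : (fun i => LipLoc.comp (π' n i) (φ' n) (hφ' n).isAdmissible.isLipLoc) =
        fun i => LipLoc.comp (π i) (φ n) (hφ n).isAdmissible.isLipLoc :=
      funext fun i => Subtype.ext (funext (hπ' n i))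
    simp only [pushforward]
    rw [ef, eπ]
  rw [h10] at h9
  rw [Real.dist_eq, abs_lt]
  rw [abs_le] at h8 h9
  constructor <;> linarith

/-- Points of the support of the limit are limits of points of the spaces `X n`. -/
theorem exists_tendsto_of_mem_spt {U : Ultrafilter ℕ} (hU : (U : Filter ℕ) ≤ atTop)
    (hTn : ∀ n, IsMultilinear (Tn n)) (hT : IsMultilinear T) (x : ∀ n, X n)
    (hconv : TendstoLocalFlat (fun n => pushforward (Tn n) (φ n) (hφ n).isAdmissible) T)
    {z : Z} (hz : z ∈ spt T) : ∃ y : ∀ n, X n, Tendsto (fun n => φ n (y n)) U (𝓝 z) := by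
  -- If the images of `X n` missed a ball about `z`, the pushed-forward functionals would vanish on
  -- a tuple supported there that detects `T`.
  have key : ∀ r > (0 : ℝ), ∀ᶠ n in (U : Filter ℕ), ∃ a, dist (φ n a) z < r := by
    intro r hr
    by_contra h
    rw [← Ultrafilter.eventually_not] at h
    obtain ⟨f, π, hf, hfM, hπ, hne⟩ := exists_ne_zero_of_mem_spt hz hr
    obtain ⟨K, hK⟩ := f.2.1
    have e1 := hU (hconv.eventually_abs_sub_le (fun n => (hTn n).pushforward _) hT z r one_pos
      (L := K + 1) (by positivity) (half_pos (abs_pos.2 hne)))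
    obtain ⟨n, h1, h2⟩ := (Eventually.and (f := (U : Filter ℕ)) e1 h).exists
    have h3 := h1 f π (hf.trans Metric.ball_subset_closedBall) hfM (hK.weaken le_self_add)
      fun i => (hπ i).weaken le_add_self
    have h4 : pushforward (Tn n) (φ n) (hφ n).isAdmissible f π = 0 := by
      have ef : LipBS.comp f (φ n) (hφ n).isAdmissible = 0 := by
        refine Subtype.ext (funext fun a => ?_)
        by_contra h0
        exact h2 ⟨a, hf (subset_tsupport f.1 h0)⟩
      simp only [pushforward]
      rw [ef]
      exact ((hTn n).1 _).map_zero
    rw [h4, sub_zero] at h3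
    linarith [abs_pos.2 hne]
  -- Almost nearest points serve all radii at once, so no diagonal argument is needed.
  have hlt : ∀ n, ∃ a, dist z (φ n a) < Metric.infDist z (range (φ n)) + 1 / ((n : ℝ) + 1) := by
    intro n
    obtain ⟨_, ⟨a, rfl⟩, ha⟩ := (Metric.infDist_lt_iff (x := z)
      (r := Metric.infDist z (range (φ n)) + 1 / ((n : ℝ) + 1)) ⟨_, mem_range_self (x n)⟩).1
      (lt_add_of_pos_right _ (by positivity))
    exact ⟨a, ha⟩
  choose y hy using hlt
  refine ⟨y, Metric.tendsto_nhds.2 fun ε hε => ?_⟩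
  have h1 : ∀ᶠ n : ℕ in (U : Filter ℕ), 1 / ((n : ℝ) + 1) < ε / 2 :=
    hU (tendsto_one_div_add_atTop_nhds_zero_nat.eventually_lt_const (half_pos hε))
  filter_upwards [h1, key _ (half_pos hε)] with n h2 ⟨a, ha⟩
  have h3 := Metric.infDist_le_dist_of_mem (x := z) (mem_range_self (f := φ n) a)
  rw [dist_comm] at ha ⊢
  linarith [hy n]

/-- If points of the spaces `X n` converge in `Z` to a point of the support of the limit, then
they converge in `Z'` to a point of the support of the limit. -/
theorem exists_tendsto_mem_spt [CompleteSpace Z'] {U : Ultrafilter ℕ}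
    (hU : (U : Filter ℕ) ≤ atTop) (hTn : ∀ n, IsMultilinear (Tn n))
    (hT : IsMultilinear T) (hT' : IsLocallyIntegerRectifiable T')
    (hconv : TendstoLocalFlat (fun n => pushforward (Tn n) (φ n) (hφ n).isAdmissible) T)
    (hconv' : TendstoLocalFlat (fun n => pushforward (Tn n) (φ' n) (hφ' n).isAdmissible) T')
    (hx : Tendsto (fun n => φ n (x n)) U (𝓝 z₀)) (hx' : Tendsto (fun n => φ' n (x n)) U (𝓝 z₀'))
    {z : Z} (hz : z ∈ spt T) {y : ∀ n, X n} (hy : Tendsto (fun n => φ n (y n)) U (𝓝 z)) :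
    ∃ w ∈ spt T', Tendsto (fun n => φ' n (y n)) U (𝓝 w) := by
  have hml := hT'.isMetricFunctional.multilinear
  set R : ℝ := dist z z₀ + 2
  have hbdd : ∀ᶠ n in (U : Filter ℕ), dist (φ' n (y n)) z₀' ≤ R := by
    have h1 := (hy.dist hx).eventually_lt_const (lt_add_one (dist z z₀))
    filter_upwards [h1, Metric.tendsto_nhds.1 hx' 1 one_pos] with n h2 h3
    have h4 := dist_triangle (φ' n (y n)) (φ' n (x n)) z₀'
    rw [(hφ' n).dist_eq, ← (hφ n).dist_eq] at h4
    simp only [R]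
    linarith
  have hmass : ∀ r > (0 : ℝ), ∃ c > (0 : ℝ), ∀ᶠ n in (U : Filter ℕ), ∀ W : Set Z',
      Metric.closedBall (φ' n (y n)) r ⊆ W → ENNReal.ofReal c < mass T' W := by
    intro r hr
    obtain ⟨f, π, hf, hfM, hπ, hne⟩ := exists_ne_zero_of_mem_spt hz (r := r / 2) (by linarith)
    obtain ⟨K, hK⟩ := f.2.1
    lift r to ℝ≥0 using hr.le
    -- The test function lives in a ball of radius `r / 2`, and the transfer enlarges the radius by
    -- `r / 4` twice.
    have hr' : 0 < r / 4 := by have : 0 < r := hr; positivity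
    obtain ⟨f', π', hf'L, hf'M, hπ'L, hf's, -, -, hlim⟩ := exists_transfer (hφ := hφ)
      (hφ' := hφ') hU hTn hT hml hconv hconv' hr' one_pos (by simpa using hfM) hK hπ
      (hf.trans Metric.ball_subset_closedBall) hy hbdd
    refine ⟨|T f π| / 2, by positivity, ?_⟩
    have hlim' := hlim.abs.eventually_const_lt (half_lt_self (abs_pos.2 hne))
    filter_upwards [hf's, hlim'] with n h1 h2 W hW
    by_contra! h
    have h3 := hml.abs_le_of_mass_le (by positivity) h (f := f' n) (h1.trans (Subset.trans
      (Metric.closedBall_subset_closedBall (by push_cast; linarith)) hW)) one_pos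
      (by simpa using hf'M n) one_pos (hπ'L n)
    simp only [NNReal.coe_one, one_pow, one_mul] at h3
    linarith
  have hcauchy : Cauchy (map (fun n => φ' n (y n)) (U : Filter ℕ)) := by
    refine Metric.cauchy_iff.2 ⟨inferInstance, fun ε hε => ?_⟩
    set r : ℝ := ε / 5
    have hr : 0 < r := by positivity
    obtain ⟨c, hc, hcW⟩ := hmass r hr
    -- The complement of `C` has mass below `c`, too little to contain the ball about `φ' n (y n)`,
    -- which must therefore meet `C`. Of the finitely many balls covering the neighbourhood of `C`,
    -- the ultrafilter selects one.
    obtain ⟨C, hCV, hCr, -, hCc⟩ := hT'.rectifiable (Metric.ball z₀' (R + r + 1))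
      Metric.isOpen_ball Metric.isBounded_ball _ (ENNReal.ofReal_pos.2 hc)
    obtain ⟨t, -, htf, hCt⟩ := hCr.isCompact.finite_cover_balls hr
    have hev : (⋃ q ∈ t, {n | dist (φ' n (y n)) q < 2 * r}) ∈ U := by
      filter_upwards [hcW, hbdd] with n h1 h2
      have h3 : ¬ Metric.closedBall (φ' n (y n)) r ⊆ Metric.ball z₀' (R + r + 1) \ C :=
        fun h => (h1 _ h).not_gt hCc
      obtain ⟨a, ha, haC⟩ := not_subset.1 h3
      have haV : a ∈ Metric.ball z₀' (R + r + 1) :=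
        Metric.closedBall_subset_ball' (by linarith) ha
      have haC' : a ∈ C := by
        by_contra h
        exact haC ⟨haV, h⟩
      obtain ⟨q, hq, haq⟩ := mem_iUnion₂.1 (hCt haC')
      refine mem_iUnion₂.2 ⟨q, hq, ?_⟩
      have := dist_triangle_left (φ' n (y n)) q a
      rw [Metric.mem_closedBall] at ha
      rw [Metric.mem_ball] at haq
      change dist (φ' n (y n)) q < 2 * r
      linarith
    obtain ⟨q, hq, hqU⟩ := (Ultrafilter.finite_biUnion_mem_iff htf).1 hev
    refine ⟨Metric.ball q (2 * r), hqU, fun a ha b hb => ?_⟩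
    have := dist_triangle_right a b q
    rw [Metric.mem_ball] at ha hb
    simp only [r] at ha hb
    linarith
  obtain ⟨w, hw⟩ := CompleteSpace.complete hcauchy
  refine ⟨w, fun r hr => ?_, hw⟩
  obtain ⟨c, hc, hcW⟩ := hmass (r / 2) (by linarith)
  obtain ⟨n, h1, h2⟩ := (hcW.and (Metric.tendsto_nhds.1 hw (r / 2) (by linarith))).exists
  exact (zero_le.trans_lt (h1 _ (Metric.closedBall_subset_closedBall' (by linarith)))).trans_le
    (mass_le_massOn subset_rfl)

theorem dist_eq_of_tendsto {l : Filter ℕ} [l.NeBot] (hφ : ∀ n, Isometry (φ n))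
    (hφ' : ∀ n, Isometry (φ' n)) {y v : ∀ n, X n} {z a : Z} {w b : Z'}
    (hy : Tendsto (fun n => φ n (y n)) l (𝓝 z)) (hy' : Tendsto (fun n => φ' n (y n)) l (𝓝 w))
    (hv : Tendsto (fun n => φ n (v n)) l (𝓝 a)) (hv' : Tendsto (fun n => φ' n (v n)) l (𝓝 b)) :
    dist w b = dist z a := by
  refine tendsto_nhds_unique (hy'.dist hv') ?_
  simpa only [(hφ _).dist_eq, (hφ' _).dist_eq] using hy.dist hv

end Comparison

/-- Equi-Lipschitz functions on `Z` that agree along the `X n` with a continuous function on `Z'`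
converge at limits of points of the `X n`. -/
theorem tendsto_of_eq_on_range {X : ℕ → Type*} {Z Z' : Type*} [MetricSpace Z] [MetricSpace Z']
    {φ : ∀ n, X n → Z} {φ' : ∀ n, X n → Z'} {l : Filter ℕ} {G : ℕ → Z → ℝ} {g : Z' → ℝ} {L : ℝ≥0}
    (hG : ∀ n, LipschitzWith L (G n)) (hg : Continuous g)
    (hGg : ∀ᶠ n in l, ∀ a, G n (φ n a) = g (φ' n a)) {y : ∀ n, X n} {z : Z} {w : Z'}
    (hy : Tendsto (fun n => φ n (y n)) l (𝓝 z)) (hy' : Tendsto (fun n => φ' n (y n)) l (𝓝 w)) :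
    Tendsto (fun n => G n z) l (𝓝 (g w)) := by
  have h1 : Tendsto (fun n => g (φ' n (y n))) l (𝓝 (g w)) := (hg.tendsto w).comp hy'
  have h2 : Tendsto (fun n => (L : ℝ) * dist (φ n (y n)) z) l (𝓝 0) := by
    simpa using (tendsto_iff_dist_tendsto_zero.1 hy).const_mul (L : ℝ)
  refine h1.congr_dist (squeeze_zero' (Eventually.of_forall fun _ => dist_nonneg) ?_ h2)
  filter_upwards [hGg] with n hn
  rw [← hn]
  exact (hG n).dist_le_mul _ _


/-! ### Equality of the limits on corresponding test functions -/

section Comparison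

variable {m : ℕ} {X : ℕ → Type*} [∀ n, MetricSpace (X n)] {x : ∀ n, X n}
  {Tn : ∀ n, Functional (X n) m}
  {Z : Type*} [MetricSpace Z] {z₀ : Z} {Z' : Type*} [MetricSpace Z'] {z₀' : Z'}
  {φ : ∀ n, X n → Z} {hφ : ∀ n, Isometry (φ n)} {φ' : ∀ n, X n → Z'} {hφ' : ∀ n, Isometry (φ' n)}
  {T : Functional Z m} {T' : Functional Z' m}

/-- If `F, P` on `Z` and `f, π` on `Z'` correspond to each other under the limit relation along the
`X n`, then the two limit functionals take the same value. -/
theorem eq_of_correspondence {l : Filter ℕ} [l.NeBot] (hl : l ≤ atTop)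
    (hTn : ∀ n, IsMultilinear (Tn n))
    (hT : IsLocallyIntegerRectifiable T) (hT' : IsLocallyIntegerRectifiable T')
    (hconv : TendstoLocalFlat (fun n => pushforward (Tn n) (φ n) (hφ n).isAdmissible) T)
    (hconv' : TendstoLocalFlat (fun n => pushforward (Tn n) (φ' n) (hφ' n).isAdmissible) T')
    (hx : Tendsto (fun n => φ n (x n)) l (𝓝 z₀)) (hx' : Tendsto (fun n => φ' n (x n)) l (𝓝 z₀'))
    {F : LipBS Z} {P : Fin m → LipLoc Z} {f : LipBS Z'} {π : Fin m → LipLoc Z'}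
    (h : ∀ z ∈ spt T, ∃ (w : Z') (y : ∀ n, X n), Tendsto (fun n => φ n (y n)) l (𝓝 z) ∧
      Tendsto (fun n => φ' n (y n)) l (𝓝 w) ∧ F.1 z = f.1 w ∧ ∀ i, (P i).1 z = (π i).1 w) :
    T F P = T' f π := by
  obtain ⟨ρ, hρ⟩ := f.2.2.subset_closedBall z₀'
  obtain ⟨ρ', hρ'⟩ := F.2.2.subset_closedBall z₀
  -- The transfer with `t = 1` puts the supports within `ρ + 2` of `φ n (x n)`, hence eventually
  -- within `ρ + 3` of `z₀`; the margin `4` keeps them in the open ball.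
  set R : ℝ := max ρ ρ' + 4
  have hρR : ρ + 4 ≤ R := add_le_add_left (le_max_left _ _) _
  have hρR' : ρ' + 4 ≤ R := add_le_add_left (le_max_right _ _) _
  have hFV : tsupport F.1 ⊆ Metric.ball z₀ R :=
    hρ'.trans (Metric.closedBall_subset_ball (by linarith))
  -- Only values near the supports matter, so arguments that are Lipschitz on bounded sets may be
  -- replaced by globally Lipschitz ones.
  obtain ⟨K₁, π₁, hπ₁, hππ₁⟩ :=
    exists_lipschitzWith_eqOn_pi π (Metric.isBounded_closedBall (x := z₀') (r := R))
  obtain ⟨K₂, P₁, hP₁, hPP₁⟩ :=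
    exists_lipschitzWith_eqOn_pi P (Metric.isBounded_ball (x := z₀) (r := R))
  rw [← hT.isMetricFunctional.congr_of_eqOn (π := P₁) (π' := P)
      fun i z hz => hPP₁ i z (hFV hz),
    ← hT'.isMetricFunctional.congr_of_eqOn (π := π₁) (π' := π) fun i z hz =>
      hππ₁ i z (Metric.closedBall_subset_closedBall (by linarith) (hρ hz))]
  obtain ⟨M, hM, hfM⟩ := LipBS.exists_bound f
  obtain ⟨N, hN, hFN⟩ := LipBS.exists_bound F
  obtain ⟨K₃, hf⟩ := f.2.1
  obtain ⟨K₄, hF⟩ := F.2.1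
  -- The transfer runs backwards, from `Z'` to `Z`: `T (Fs n) (Ps n)` tends to `T' f π₁`, and also
  -- to `T F P₁` because the arguments converge on `spt T`.
  obtain ⟨Fs, Ps, hFsL, hFsM, hPsL, hFss, hFsf, hPsπ, hlim⟩ := exists_transfer (hφ := hφ')
    (hφ' := hφ) hl hTn hT'.isMetricFunctional.multilinear hT.isMetricFunctional.multilinear hconv'
    hconv one_pos hM hfM hf hπ₁ hρ hx' (Filter.Tendsto.eventually_le_const
      (u := (1 : ℝ)) one_pos (tendsto_iff_dist_tendsto_zero.1 hx))
  set L : ℝ≥0 := K₁ + K₂ + (K₃ + M * 1⁻¹) + K₄ + 1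
  have hL : 0 < L := by positivity
  have e1 : K₁ ≤ L := by
    simp only [L, add_assoc]; exact le_self_add
  have e2 : K₂ ≤ L := by
    simp only [L]; rw [add_comm K₁]; simp only [add_assoc]; exact le_self_add
  have e3 : K₃ + M * 1⁻¹ ≤ L := by
    simp only [L]; rw [add_comm (K₁ + K₂), add_assoc, add_assoc]; exact le_self_add
  have e4 : K₄ ≤ L := le_add_self.trans le_self_add
  have hmax : ∀ z, |F.1 z| ≤ max M N := fun z => (hFN z).trans (le_max_right _ _)
  have hcont : ∀ z ∈ spt T ∩ Metric.ball z₀ R,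
      Tendsto (fun n => (Fs n).1 z) l (𝓝 (F.1 z)) ∧
        ∀ i, Tendsto (fun n => (Ps n i).1 z) l (𝓝 ((P₁ i).1 z)) := by
    rintro z ⟨hz, hzV⟩
    obtain ⟨w, y, hy, hy', hFf, hPπ⟩ := h z hz
    have hw : w ∈ Metric.closedBall z₀' R := by
      rw [Metric.mem_closedBall, dist_eq_of_tendsto hφ hφ' hy hy' hx hx']
      exact (Metric.mem_ball.1 hzV).le
    refine ⟨?_, fun i => ?_⟩
    · rw [hFf]
      exact tendsto_of_eq_on_range hFsL hf.continuous hFsf hy hy'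
    · rw [hPP₁ i z hzV, hPπ, ← hππ₁ i w hw]
      exact tendsto_of_eq_on_range (fun n => hPsL n i) (hπ₁ i).continuous
        (Eventually.of_forall fun n => hPsπ n i) hy hy'
  refine tendsto_nhds_unique (hT.tendsto Metric.isOpen_ball Metric.isBounded_ball hFV
    (M := max M N) (lt_max_of_lt_left hM) hmax hL (hF.weaken e4) (fun i => (hP₁ i).weaken e2) ?_
    (Eventually.of_forall fun n z => (hFsM n z).trans (le_max_left _ _))
    (Eventually.of_forall fun n => (hFsL n).weaken e3)
    (Eventually.of_forall fun n i => (hPsL n i).weaken e1)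
    (fun z hz => (hcont z hz).1) fun z hz => (hcont z hz).2) hlim
  filter_upwards [hFss, Metric.tendsto_nhds.1 hx 1 one_pos] with n h1 h2
  refine h1.trans (Metric.closedBall_subset_ball' ?_)
  push_cast
  linarith

end Comparison

end MetricCurrents

/-! ### The isometry between the supports -/

theorem proposition1p2 (m : ℕ)
    (X : ℕ → Type*) [∀ n, MetricSpace (X n)] [∀ n, CompleteSpace (X n)]
    (x : ∀ n, X n) (Tn : ∀ n, MetricCurrents.Functional (X n) m)
    (hTn : ∀ n, MetricCurrents.IsLocallyIntegral (Tn n))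
    (Z : Type*) [MetricSpace Z] [CompleteSpace Z] (z₀ : Z)
    (Z' : Type*) [MetricSpace Z'] [CompleteSpace Z'] (z₀' : Z')
    (φ : ∀ n, X n → Z) (hφ : ∀ n, Isometry (φ n))
    (φ' : ∀ n, X n → Z') (hφ' : ∀ n, Isometry (φ' n))
    (hx : Tendsto (fun n => φ n (x n)) atTop (𝓝 z₀))
    (hx' : Tendsto (fun n => φ' n (x n)) atTop (𝓝 z₀'))
    (T : MetricCurrents.Functional Z m) (hT : MetricCurrents.IsLocallyIntegral T)
    (T' : MetricCurrents.Functional Z' m) (hT' : MetricCurrents.IsLocallyIntegral T')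
    (hconv : MetricCurrents.TendstoLocalFlat
      (fun n => MetricCurrents.pushforward (Tn n) (φ n) (hφ n).isAdmissible) T)
    (hconv' : MetricCurrents.TendstoLocalFlat
      (fun n => MetricCurrents.pushforward (Tn n) (φ' n) (hφ' n).isAdmissible) T') :
    ∃ ψ : ↥({z₀} ∪ MetricCurrents.spt T) ≃ᵢ ↥({z₀'} ∪ MetricCurrents.spt T'),
      ψ ⟨z₀, Or.inl rfl⟩ = ⟨z₀', Or.inl rfl⟩ ∧
      MetricCurrents.pushforward (MetricCurrents.onSubset T ({z₀} ∪ MetricCurrents.spt T))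
        (fun y => (ψ y : Z')) ψ.isometry.isAdmissible_coe = T' := by

  -- One ultrafilter makes all the limits simultaneous, so no subsequences have to be extracted.
  let U : Ultrafilter ℕ := hyperfilter ℕ
  have hU : (U : Filter ℕ) ≤ atTop := by
    rw [← Nat.cofinite_eq_atTop]; exact hyperfilter_le_cofinite
  have hml := fun n => (hTn n).isMultilinear
  have hR := hT.isLocallyIntegerRectifiable
  have hR' := hT'.isLocallyIntegerRectifiable
  have hxU := hx.mono_left hU
  have hxU' := hx'.mono_left hU
  have hfor : ∀ z : ↥({z₀} ∪ MetricCurrents.spt T), ∃ w : ↥({z₀'} ∪ MetricCurrents.spt T'),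
      ∃ y : ∀ n, X n, Tendsto (fun n => φ n (y n)) U (𝓝 (z : Z)) ∧
        Tendsto (fun n => φ' n (y n)) U (𝓝 (w : Z')) := by
    rintro ⟨z, rfl | hz⟩
    · exact ⟨⟨z₀', Or.inl rfl⟩, x, hxU, hxU'⟩
    · obtain ⟨y, hy⟩ := MetricCurrents.exists_tendsto_of_mem_spt (hφ := hφ) hU hml
        hT.isMultilinear x hconv hz
      obtain ⟨w, hw, hyw⟩ := MetricCurrents.exists_tendsto_mem_spt (hφ := hφ) (hφ' := hφ') hU hml
        hT.isMultilinear hR' hconv hconv' hxU hxU' hz hy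
      exact ⟨⟨w, Or.inr hw⟩, y, hy, hyw⟩
  have hback : ∀ w : ↥({z₀'} ∪ MetricCurrents.spt T'), ∃ z : ↥({z₀} ∪ MetricCurrents.spt T),
      ∃ y : ∀ n, X n, Tendsto (fun n => φ n (y n)) U (𝓝 (z : Z)) ∧
        Tendsto (fun n => φ' n (y n)) U (𝓝 (w : Z')) := by
    rintro ⟨w, rfl | hw⟩
    · exact ⟨⟨z₀, Or.inl rfl⟩, x, hxU, hxU'⟩
    · obtain ⟨y, hy⟩ := MetricCurrents.exists_tendsto_of_mem_spt (hφ := hφ') hU hml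
        hT'.isMultilinear x hconv' hw
      obtain ⟨z, hz, hyz⟩ := MetricCurrents.exists_tendsto_mem_spt (hφ := hφ') (hφ' := hφ) hU hml
        hT'.isMultilinear hR hconv' hconv hxU' hxU hw hy
      exact ⟨⟨z, Or.inr hz⟩, y, hyz, hy⟩
  choose ψ y hy hy' using hfor
  have hψ : Isometry ψ := Isometry.of_dist_eq fun a b =>
    MetricCurrents.dist_eq_of_tendsto hφ hφ' (hy a) (hy' a) (hy b) (hy' b)
  -- The image of a point does not depend on the approximating sequence; this gives both
  -- surjectivity and `ψ z₀ = z₀'`.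
  have huniq : ∀ (z : ↥({z₀} ∪ MetricCurrents.spt T)) (w : ↥({z₀'} ∪ MetricCurrents.spt T'))
      (v : ∀ n, X n), Tendsto (fun n => φ n (v n)) U (𝓝 (z : Z)) →
      Tendsto (fun n => φ' n (v n)) U (𝓝 (w : Z')) → ψ z = w := by
    intro z w v hv hv'
    refine Subtype.ext (dist_eq_zero.1 ?_)
    rw [MetricCurrents.dist_eq_of_tendsto hφ hφ' (hy z) (hy' z) hv hv', dist_self]
  have hsurj : Function.Surjective ψ := fun w => by
    obtain ⟨z, v, hv, hv'⟩ := hback w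
    exact ⟨z, huniq z w v hv hv'⟩
  refine ⟨⟨Equiv.ofBijective ψ ⟨hψ.injective, hsurj⟩, hψ⟩, huniq _ _ x hxU hxU', ?_⟩
  funext f π
  -- The extensions chosen in `onSubset` enter only through their values on `spt T`, where they
  -- agree with `f ∘ ψ` and `π ∘ ψ`.
  refine MetricCurrents.eq_of_correspondence (hφ := hφ) (hφ' := hφ') hU hml hR hR' hconv
    hconv' hxU hxU' fun z hz => ?_
  refine ⟨_, y ⟨z, Or.inr hz⟩, hy _, hy' _, ?_, fun i => ?_⟩
  · exact (MetricCurrents.LipBS.exists_extension _).choose_spec ⟨z, Or.inr hz⟩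
  · exact (MetricCurrents.LipLoc.exists_extension _).choose_spec ⟨z, Or.inr hz⟩
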